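/- Let $M$ be a finite-dimensional smooth manifold and let $L:A\to\mathbb R$ be a (conic, two-homogeneous) pseudo-Finsler metric on $M$. That is, $A\subset TM\setminus\mathbf 0$ is open, projects onto $M$ and satisfies $\lambda v\in A$ for $v\in A$, $\lambda>0$; $L$ is smooth with $L(\lambda v)=\lambda^2L(v)$ for $v\in A$, $\lambda>0$; and for every $v\in A$, with foot point $p$, the fundamental tensor $$g_v(u,w)=\tfrac12\left.\tfrac{\partial^2}{\partial t\,\partial s}L(v+tu+sw)\right|_{t=s=0}\qquad(u,w\in T_pM)$$ is nondegenerate. Let $C_v(w_1,w_2,w_3)=\frac14\left.\frac{\partial^3}{\partial s_3\partial s_2\partial s_1}L(v+\sum_i s_iw_i)\right|_{s_1=s_2=s_3=0}$ be the Cartan tensor. For a smooth $A$-valued vector field $V$ on an open set, the Chern connection $\nabla^V$ is the unique torsion-free affine connection there with $$X(g_V(Y,Z))=g_V(\nabla^V_XY,Z)+g_V(Y,\nabla^V_XZ)+2C_V(\nabla^V_XV,Y,Z).$$ In a chart its Christoffel symbols have the form $\Gamma^k_{ij}\circ V$ for functions $\Gamma^k_{ij}$ on the part of $A$ over the chart domain.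 For a smooth curve $\gamma$ and an $A$-valued vector field $W$ along $\gamma$, the covariant derivative $D^W_\gamma X$ has the components $\dot X^k+\sum_{i,j}X^i\dot\gamma^j\,\Gamma^k_{ij}(W)$. A geodesic is a smooth curve $\gamma:[a,b]\to M$ ($a<b$) with $\dot\gamma(t)\in A$ for all $t$ and $D^{\dot\gamma}_\gamma\dot\gamma=0$. For vector fields along a geodesic write $X'=D^{\dot\gamma}_\gamma X$. A Jacobi field along $\gamma$ is a smooth vector field $J$ along $\gamma$ with $J''=R^\gamma(\dot\gamma,J)\dot\gamma$. Here $$R^\gamma(\dot\gamma,W)Z=\left.\left(D^{\Lambda_t}_{\gamma_s}D^{\Lambda_t}_{\beta_t}\tilde Z-D^{\Lambda_t}_{\beta_t}D^{\Lambda_t}_{\gamma_s}\tilde Z\right)\right|_{s=0}$$ for any smooth variation $\Lambda(t,s)=\gamma_s(t)=\beta_t(s)$ of $\gamma=\gamma_0$ with $\Lambda_t=\dot\gamma_s\in A$ and $\Lambda_s(\cdot,0)=W$, and any smooth extension $\tilde Z$ of $Z$ to $\Lambda$; the result does not depend on these choices. Let $\gamma:[a,b]\to M$ be a geodesic. If $J$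 is a Jacobi field along $\gamma$, then: (i) $J$ is tangent to $\gamma$ (that is, $J(t)\in\operatorname{span}(\dot\gamma(t))$ for all $t\in[a,b]$) if and only if there are $a_1,a_2\in\mathbb R$ with $J(t)=(a_1t+a_2)\dot\gamma(t)$ for all $t\in[a,b]$. (ii) The following are equivalent: (a) $g_{\dot\gamma(t)}(\dot\gamma(t),J(t))=0$ for all $t\in[a,b]$; (b) there are two distinct instants $t_1\neq t_2$ in $[a,b]$ with $g_{\dot\gamma(t_i)}(\dot\gamma(t_i),J(t_i))=0$ for $i=1,2$; (c) there is an instant $t_0\in[a,b]$ with $g_{\dot\gamma(t_0)}(\dot\gamma(t_0),J(t_0))=0$ and $g_{\dot\gamma(t_0)}(\dot\gamma(t_0),J'(t_0))=0$. (iii) Moreover, if $\gamma$ is nonnull, that is, $L(\dot\gamma(t))\neq0$ for all $t\in[a,b]$, then a smooth vector field $J$ along $\gamma$ is a Jacobi field if and only if both $\operatorname{nor}_\gamma(J)$ and $\operatorname{tan}_\gamma(J)$ are Jacobi fields, where $\operatorname{tan}_\gamma(J)$ and $\operatorname{nor}_\gamma(J)$ are the projections of $J$ to the two summands of $T_{\gamma(t)}M=\operatorname{span}(\dot\gamma(t))\oplus\{v: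 g_{\dot\gamma(t)}(\dot\gamma(t),v)=0\}$. -/

import Mathlib

open Set
open scoped Manifold ContDiff

/-- The fundamental tensor `g_v(u, w) = ½ ∂²/∂t∂s L(v + t u + s w)` at `t = s = 0`, computed in the
tangent space `T_p M`. -/
noncomputable def fundamentalTensor {E : Type*} [NormedAddCommGroup E] [NormedSpace ℝ E]
    {M : Type*} [TopologicalSpace M] [ChartedSpace E M]
    (L : TangentBundle 𝓘(ℝ, E) M → ℝ) {p : M} (v u w : TangentSpace 𝓘(ℝ, E) p) : ℝ :=
  (1 / 2) * deriv (fun t : ℝ => deriv (fun s : ℝ => L ⟨p, v + t • u + s • w⟩) 0) 0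

/-- The Cartan tensor
`C_v(w₁, w₂, w₃) = ¼ ∂³/∂s₃∂s₂∂s₁ L(v + s₁ w₁ + s₂ w₂ + s₃ w₃)` at `s₁ = s₂ = s₃ = 0`. -/
noncomputable def cartanTensor {E : Type*} [NormedAddCommGroup E] [NormedSpace ℝ E]
    {M : Type*} [TopologicalSpace M] [ChartedSpace E M]
    (L : TangentBundle 𝓘(ℝ, E) M → ℝ) {p : M} (v w₁ w₂ w₃ : TangentSpace 𝓘(ℝ, E) p) : ℝ :=
  (1 / 4) * deriv (fun s₃ : ℝ => deriv (fun s₂ : ℝ => deriv (fun s₁ : ℝ =>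
    L ⟨p, v + s₁ • w₁ + s₂ • w₂ + s₃ • w₃⟩) 0) 0) 0

/-- A (conic, two-homogeneous) pseudo-Finsler metric on a smooth manifold `M`: an open conic set
`domain ⊆ TM ∖ 0` projecting onto `M` and a smooth function `L` on it, positively homogeneous of
degree two, with nondegenerate fundamental tensor. The function `L` is total in Lean; only its
values on `domain` matter. -/
structure PseudoFinslerMetric (E : Type*) [NormedAddCommGroup E] [NormedSpace ℝ E]
    (M : Type*) [TopologicalSpace M] [ChartedSpace E M] [IsManifold 𝓘(ℝ, E) ∞ M] where
  domain : Set (TangentBundle 𝓘(ℝ, E) M)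
  L : TangentBundle 𝓘(ℝ, E) M → ℝ
  isOpen_domain : IsOpen domain
  zero_notMem : ∀ p : M, (⟨p, 0⟩ : TangentBundle 𝓘(ℝ, E) M) ∉ domain
  proj_surjective : ∀ p : M, ∃ v : TangentSpace 𝓘(ℝ, E) p,
    (⟨p, v⟩ : TangentBundle 𝓘(ℝ, E) M) ∈ domain
  conic : ∀ (p : M) (v : TangentSpace 𝓘(ℝ, E) p) (r : ℝ), 0 < r →
    (⟨p, v⟩ : TangentBundle 𝓘(ℝ, E) M) ∈ domain → (⟨p, r • v⟩ : TangentBundle 𝓘(ℝ, E) M) ∈ domain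
  smooth : ContMDiffOn 𝓘(ℝ, E).tangent 𝓘(ℝ, ℝ) ∞ L domain
  homogeneous : ∀ (p : M) (v : TangentSpace 𝓘(ℝ, E) p) (r : ℝ), 0 < r →
    (⟨p, v⟩ : TangentBundle 𝓘(ℝ, E) M) ∈ domain → L ⟨p, r • v⟩ = r ^ 2 * L ⟨p, v⟩
  nondegenerate : ∀ (p : M) (v : TangentSpace 𝓘(ℝ, E) p),
    (⟨p, v⟩ : TangentBundle 𝓘(ℝ, E) M) ∈ domain →
    ∀ u : TangentSpace 𝓘(ℝ, E) p, (∀ w, fundamentalTensor L v u w = 0) → u = 0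

/-- The algebraic part: `g` nondegenerate and symmetric, `C` symmetric and vanishing on `y`. -/
theorem chernAlg {E : Type*} [NormedAddCommGroup E] [NormedSpace ℝ E] [FiniteDimensional ℝ E]
    (g : E →L[ℝ] E →L[ℝ] ℝ) (C D : E →L[ℝ] E →L[ℝ] E →L[ℝ] ℝ) (y : E)
    (gs : ∀ u w, g u w = g w u) (gn : ∀ u, (∀ w, g u w = 0) → u = 0)
    (C1 : ∀ u v w, C u v w = C v u w) (C2 : ∀ u v w, C u v w = C u w v)
    (C0 : ∀ u w, C y u w = 0) (D2 : ∀ u v w, D u v w = D u w v) :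
    ∃! Γ : E →L[ℝ] E →L[ℝ] E, (∀ X Y, Γ X Y = Γ Y X) ∧
      ∀ X Y Z, D X Y Z = g (Γ X Y) Z + g Y (Γ X Z) + 2 * C (Γ X y) Y Z := by
  have C0' : ∀ u w, C u y w = 0 := fun u w => by rw [C1, C0]
  have C0'' : ∀ u w, C u w y = 0 := fun u w => by rw [C2, C0']
  obtain ⟨s, hs⟩ : ∃ s : (E →L[ℝ] ℝ) →ₗ[ℝ] E, ∀ α z, g (s α) z = α z := by
    have inj : Function.Injective (g : E →ₗ[ℝ] (E →L[ℝ] ℝ)) := by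
      rw [injective_iff_map_eq_zero]
      intro u hu
      exact gn u fun w => by simpa using congrArg (fun f : E →L[ℝ] ℝ => f w) hu
    have hd : Module.finrank ℝ E = Module.finrank ℝ (E →L[ℝ] ℝ) := by
      rw [← (LinearMap.toContinuousLinearMap (𝕜 := ℝ) (E := E) (F' := ℝ)).finrank_eq]
      exact (Subspace.dual_finrank_eq (K := ℝ) (V := E)).symm
    refine ⟨(LinearEquiv.ofInjectiveOfFinrankEq _ inj hd).symm, fun α z => ?_⟩
    have := (LinearEquiv.ofInjectiveOfFinrankEq _ inj hd).apply_symm_apply α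
    exact congrArg (fun f : E →L[ℝ] ℝ => f z) this
  have ext : ∀ u v : E, (∀ z, g u z = g v z) → u = v := fun u v h => by
    rw [← sub_eq_zero]; exact gn _ fun w => by simp [h]
  let G0 : E := s (D y y - (1 / 2 : ℝ) • (D.flip y).flip y)
  let N : E →ₗ[ℝ] E :=
    { toFun := fun X => s ((1 / 2 : ℝ) • (D X y + D y X - (D.flip X).flip y) - C G0 X)
      map_add' := fun X X' => ext _ _ fun z => by simp [hs]; ring
      map_smul' := fun r X => ext _ _ fun z => by simp [hs]; ring }
  let N' : E →L[ℝ] E := LinearMap.toContinuousLinearMap N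
  have hN : ∀ X z, g (N' X) z = (1 / 2) * (D X y z + D y X z - D z X y) - C G0 X z := by
    intro X z; simp [N', N, hs]
  have hG : N' y = G0 := ext _ _ fun z => by rw [hN, C0']; simp [G0, hs]; ring
  let B : E →ₗ[ℝ] E →ₗ[ℝ] E := LinearMap.mk₂ ℝ (fun X Y =>
      s ((1 / 2 : ℝ) • (D X Y + D Y X - (D.flip X).flip Y) -
        (C (N' X) Y + C (N' Y) X - ((C.comp N').flip X).flip Y)))
    (fun X X' Y => ext _ _ fun z => by simp [hs]; ring)
    (fun r X Y => ext _ _ fun z => by simp [hs]; ring)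
    (fun X Y Y' => ext _ _ fun z => by simp [hs]; ring)
    (fun r X Y => ext _ _ fun z => by simp [hs]; ring)
  let Γ : E →L[ℝ] E →L[ℝ] E := LinearMap.toContinuousLinearMap
    ((LinearMap.toContinuousLinearMap (𝕜 := ℝ) (E := E) (F' := E)).toLinearMap ∘ₗ B)
  have hΓ : ∀ X Y z, g (Γ X Y) z = (1 / 2) * (D X Y z + D Y X z - D z X Y) -
      (C (N' X) Y z + C (N' Y) X z - C (N' z) X Y) := by
    intro X Y z; simp [Γ, B, hs]
  have hy : ∀ X, Γ X y = N' X := fun X => ext _ _ fun z => by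
    rw [hΓ, hN, hG, C0', C0'']; ring
  refine ⟨Γ, ⟨fun X Y => ext _ _ fun z => ?_, fun X Y Z => ?_⟩, ?_⟩
  · rw [hΓ, hΓ, D2 z X Y, C2 (N' z) X Y]; ring
  · rw [gs Y, hΓ, hΓ, hy, D2 Y X Z, D2 Z X Y, D2 X Z Y, C2 (N' Y) X Z, C2 (N' X) Z Y,
      C2 (N' Z) X Y]; ring
  · rintro Γ' ⟨h1, h2⟩
    have K : ∀ X Y z, g (Γ' X Y) z = (1 / 2) * (D X Y z + D Y X z - D z X Y) -
        (C (Γ' X y) Y z + C (Γ' Y y) X z - C (Γ' z y) X Y) := by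
      intro X Y z
      rw [h2 X Y z, h2 Y X z, h2 z X Y, h1 Y X, h1 z X, h1 z Y, gs X (Γ' Y z), gs Y]
      ring
    have k1 : Γ' y y = G0 := ext _ _ fun z => by
      rw [K]; simp [G0, hs, C0']; ring
    have k2 : ∀ X, Γ' X y = N' X := fun X => ext _ _ fun z => by
      rw [K, hN, k1, C0', C0'']; ring
    ext X Y
    exact ext _ _ fun z => by rw [K, hΓ, k2, k2, k2]

section
variable {V : Type*} [NormedAddCommGroup V] [NormedSpace ℝ V] {F : V → ℝ} {U : Set V}

theorem contDiffOn_fderiv_aux {W : Type*} [NormedAddCommGroup W] [NormedSpace ℝ W] {f : V → W}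
    (hU : IsOpen U) (hf : ContDiffOn ℝ ∞ f U) : ContDiffOn ℝ ∞ (fderiv ℝ f) U :=
  hf.fderiv_of_isOpen hU (by simp)

theorem differentiableAt_aux {W : Type*} [NormedAddCommGroup W] [NormedSpace ℝ W] {f : V → W}
    (hU : IsOpen U) (hf : ContDiffOn ℝ ∞ f U) {z : V} (hz : z ∈ U) : DifferentiableAt ℝ f z :=
  (hf.contDiffAt (hU.mem_nhds hz)).differentiableAt (by simp)

theorem hasDerivAt_line_aux {W : Type*} [NormedAddCommGroup W] [NormedSpace ℝ W] {f : V → W}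
    {z : V} (hf : DifferentiableAt ℝ f z) (u : V) :
    HasDerivAt (fun t : ℝ => f (z + t • u)) (fderiv ℝ f z u) 0 := by
  have h1 : HasDerivAt (fun t : ℝ => z + t • u) u 0 := by
    simpa using ((hasDerivAt_id (0 : ℝ)).smul_const u).const_add z
  have h2 : HasFDerivAt f (fderiv ℝ f z) (z + (0 : ℝ) • u) := by simpa using hf.hasFDerivAt
  exact h2.comp_hasDerivAt (0 : ℝ) h1

theorem eventually_line_aux (hU : IsOpen U) {z : V} (hz : z ∈ U) (u : V) :
    ∀ᶠ t : ℝ in nhds 0, z + t • u ∈ U := by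
  have h1 : Continuous fun t : ℝ => z + t • u := by fun_prop
  exact h1.continuousAt.preimage_mem_nhds (hU.mem_nhds (by simpa using hz))

theorem deriv2_aux (hU : IsOpen U) (hF : ContDiffOn ℝ ∞ F U) {z : V} (hz : z ∈ U) (u w : V) :
    deriv (fun t : ℝ => deriv (fun s : ℝ => F (z + t • u + s • w)) 0) 0 =
      fderiv ℝ (fderiv ℝ F) z u w := by
  have h1 : (fun t : ℝ => deriv (fun s : ℝ => F (z + t • u + s • w)) 0) =ᶠ[nhds 0]
      fun t : ℝ => fderiv ℝ F (z + t • u) w := by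
    filter_upwards [eventually_line_aux hU hz u] with t ht
    exact (hasDerivAt_line_aux (differentiableAt_aux hU hF ht) w).deriv
  rw [h1.deriv_eq]
  have h2 := hasDerivAt_line_aux
    (differentiableAt_aux hU (contDiffOn_fderiv_aux hU hF) hz) u
  exact (h2.clm_apply (hasDerivAt_const (0 : ℝ) w)).deriv.trans (by simp)

theorem deriv3_aux (hU : IsOpen U) (hF : ContDiffOn ℝ ∞ F U) {z : V} (hz : z ∈ U) (u v w : V) :
    deriv (fun r : ℝ => deriv (fun t : ℝ => deriv (fun s : ℝ =>
      F (z + s • w + t • v + r • u)) 0) 0) 0 =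
      fderiv ℝ (fderiv ℝ (fderiv ℝ F)) z u v w := by
  have h1 : (fun r : ℝ => deriv (fun t : ℝ => deriv (fun s : ℝ =>
      F (z + s • w + t • v + r • u)) 0) 0) =ᶠ[nhds 0]
      fun r : ℝ => fderiv ℝ (fderiv ℝ F) (z + r • u) v w := by
    filter_upwards [eventually_line_aux hU hz u] with r hr
    rw [← deriv2_aux hU hF hr]
    have hc : ∀ s t : ℝ, z + s • w + t • v + r • u = z + r • u + t • v + s • w :=
      fun s t => by abel
    simp only [hc]
  rw [h1.deriv_eq]
  have h2 := hasDerivAt_line_aux (differentiableAt_aux hU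
    (contDiffOn_fderiv_aux hU (contDiffOn_fderiv_aux hU hF)) hz) u
  exact ((h2.clm_apply (hasDerivAt_const (0 : ℝ) v)).clm_apply
    (hasDerivAt_const (0 : ℝ) w)).deriv.trans (by simp)

end

theorem mdifferentiable_of_mem_maximalAtlas_aux {E : Type*} [NormedAddCommGroup E]
    [NormedSpace ℝ E] {M : Type*} [TopologicalSpace M] [ChartedSpace E M]
    [IsManifold 𝓘(ℝ, E) ∞ M] (e : OpenPartialHomeomorph M E)
    (he : e ∈ IsManifold.maximalAtlas 𝓘(ℝ, E) ∞ M) :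
    e.MDifferentiable 𝓘(ℝ, E) 𝓘(ℝ, E) :=
  ⟨(contMDiffOn_of_mem_maximalAtlas he).mdifferentiableOn (by simp),
    (contMDiffOn_symm_of_mem_maximalAtlas he).mdifferentiableOn (by simp)⟩

namespace PseudoFinslerMetric

/-- The tangent vector at `e.symm x` with coordinates `y` in the chart `e`. -/
noncomputable def ofCoord {E : Type*} [NormedAddCommGroup E] [NormedSpace ℝ E]
    {M : Type*} [TopologicalSpace M] [ChartedSpace E M]
    (e : OpenPartialHomeomorph M E) (x y : E) : TangentSpace 𝓘(ℝ, E) (e.symm x) :=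
  mfderiv 𝓘(ℝ, E) 𝓘(ℝ, E) e.symm x y

section

variable {E : Type*} [NormedAddCommGroup E] [NormedSpace ℝ E]
  {M : Type*} [TopologicalSpace M] [ChartedSpace E M]

theorem ofCoord_add (e : OpenPartialHomeomorph M E) (x u w : E) :
    ofCoord e x (u + w) = ofCoord e x u + ofCoord e x w :=
  map_add (mfderiv 𝓘(ℝ, E) 𝓘(ℝ, E) e.symm x) u w

theorem ofCoord_smul (e : OpenPartialHomeomorph M E) (x : E) (r : ℝ) (u : E) :
    ofCoord e x (r • u) = r • ofCoord e x u :=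
  map_smul (mfderiv 𝓘(ℝ, E) 𝓘(ℝ, E) e.symm x) r u

end

/-- The coordinates in the chart `e` of a vector field along a curve. -/
noncomputable def coordField {E : Type*} [NormedAddCommGroup E] [NormedSpace ℝ E]
    {M : Type*} [TopologicalSpace M] [ChartedSpace E M]
    (e : OpenPartialHomeomorph M E) (γ : ℝ → M) (X : ∀ t, TangentSpace 𝓘(ℝ, E) (γ t))
    (t : ℝ) : E :=
  mfderiv 𝓘(ℝ, E) 𝓘(ℝ, E) e (γ t) (X t)

/-- The velocity `γ̇(t)` of a curve defined on `S ⊆ ℝ` (one-sided at the endpoints of an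
interval). -/
noncomputable def velocity {E : Type*} [NormedAddCommGroup E] [NormedSpace ℝ E]
    {M : Type*} [TopologicalSpace M] [ChartedSpace E M]
    (S : Set ℝ) (γ : ℝ → M) (t : ℝ) : TangentSpace 𝓘(ℝ, E) (γ t) :=
  mfderivWithin 𝓘(ℝ, ℝ) 𝓘(ℝ, E) γ S t (1 : ℝ)

section

variable {E : Type*} [NormedAddCommGroup E] [NormedSpace ℝ E]
  {M : Type*} [TopologicalSpace M] [ChartedSpace E M] [IsManifold 𝓘(ℝ, E) ∞ M]
  (G : PseudoFinslerMetric E M)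

/-- The coordinate expression of the fundamental tensor at the vector with coordinates `(x, y)`. -/
noncomputable def gCoord (e : OpenPartialHomeomorph M E) (x y u w : E) : ℝ :=
  fundamentalTensor G.L (ofCoord e x y) (ofCoord e x u) (ofCoord e x w)

/-- The coordinate expression of the Cartan tensor at the vector with coordinates `(x, y)`. -/
noncomputable def cartanCoord (e : OpenPartialHomeomorph M E) (x y w₁ w₂ w₃ : E) : ℝ :=
  cartanTensor G.L (ofCoord e x y) (ofCoord e x w₁) (ofCoord e x w₂) (ofCoord e x w₃)

/-- The defining properties of the Christoffel symbols `Γ = Γ_e(x, y)` of the Chern connection in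
the chart `e`, where `Γ X Y` has components `∑ Γᵏᵢⱼ Xⁱ Yʲ`. Writing `∇^V_X Y = Γ X Y` for fields
`V, X, Y` with constant coordinates (`V = y`), they are torsion-freeness, and almost
`g`-compatibility
`X (g_V(Y, Z)) = g_V(∇^V_X Y, Z) + g_V(Y, ∇^V_X Z) + 2 C_V(∇^V_X V, Y, Z)` at the point `x`. -/
structure IsChernSymbol (e : OpenPartialHomeomorph M E) (x y : E) (Γ : E →L[ℝ] E →L[ℝ] E) :
    Prop where
  torsionFree : ∀ X Y : E, Γ X Y = Γ Y X
  compatible : ∀ X Y Z : E, fderiv ℝ (fun x' => G.gCoord e x' y Y Z) x X =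
    G.gCoord e x y (Γ X Y) Z + G.gCoord e x y Y (Γ X Z) + 2 * G.cartanCoord e x y (Γ X y) Y Z

/-- The coordinate expression of `L` in the chart `e`. -/
noncomputable def lCoord (e : OpenPartialHomeomorph M E) (q : E × E) : ℝ :=
  G.L ⟨e.symm q.1, ofCoord e q.1 q.2⟩

/-- The domain of the coordinate expression of `L` in the chart `e`. -/
def domainCoord (e : OpenPartialHomeomorph M E) : Set (E × E) :=
  {q | q.1 ∈ e.target ∧
    (⟨e.symm q.1, ofCoord e q.1 q.2⟩ : TangentBundle 𝓘(ℝ, E) M) ∈ G.domain}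

theorem contMDiffOn_ofCoord (e : OpenPartialHomeomorph M E)
    (he : e ∈ IsManifold.maximalAtlas 𝓘(ℝ, E) ∞ M) :
    ContMDiffOn 𝓘(ℝ, E × E) 𝓘(ℝ, E).tangent ∞
      (fun q : E × E => (⟨e.symm q.1, ofCoord e q.1 q.2⟩ : TangentBundle 𝓘(ℝ, E) M))
      {q | q.1 ∈ e.target} := by
  have h1 := (contMDiffOn_symm_of_mem_maximalAtlas he).contMDiffOn_tangentMapWithin
    (m := ∞) (by simp) e.open_target.uniqueMDiffOn
  have h2 := contMDiff_tangentBundleModelSpaceHomeomorph_symm (I := 𝓘(ℝ, E)) (n := ∞)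
  have h3 := h1.comp (h2.contMDiffOn (s := {q : ModelProd E E | q.1 ∈ e.target}))
    (fun q hq => hq)
  have h4 : ContMDiffOn 𝓘(ℝ, E × E) 𝓘(ℝ, E).tangent ∞
      (fun q : E × E => tangentMapWithin 𝓘(ℝ, E) 𝓘(ℝ, E) e.symm e.target
        ((tangentBundleModelSpaceHomeomorph 𝓘(ℝ, E)).symm q)) {q : E × E | q.1 ∈ e.target} := by
    rw [modelWithCornersSelf_prod]
    exact h3
  refine h4.congr fun q hq => ?_
  have : mfderivWithin 𝓘(ℝ, E) 𝓘(ℝ, E) e.symm e.target q.1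
      = mfderiv 𝓘(ℝ, E) 𝓘(ℝ, E) e.symm q.1 :=
    mfderivWithin_of_mem_nhds (e.open_target.mem_nhds hq)
  change _ = (⟨e.symm q.1, mfderivWithin 𝓘(ℝ, E) 𝓘(ℝ, E) e.symm e.target q.1 q.2⟩ :
    TangentBundle 𝓘(ℝ, E) M)
  rw [this]
  rfl

theorem isOpen_domainCoord (e : OpenPartialHomeomorph M E)
    (he : e ∈ IsManifold.maximalAtlas 𝓘(ℝ, E) ∞ M) : IsOpen (G.domainCoord e) :=
  (contMDiffOn_ofCoord e he).continuousOn.isOpen_inter_preimage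
    (e.open_target.preimage continuous_fst) G.isOpen_domain

theorem contDiffOn_lCoord (e : OpenPartialHomeomorph M E)
    (he : e ∈ IsManifold.maximalAtlas 𝓘(ℝ, E) ∞ M) :
    ContDiffOn ℝ ∞ (G.lCoord e) (G.domainCoord e) :=
  contMDiffOn_iff_contDiffOn.1 (G.smooth.comp ((contMDiffOn_ofCoord e he).mono fun _ h => h.1)
    fun _ h => h.2)

theorem gCoord_eq {e : OpenPartialHomeomorph M E}
    (he : e ∈ IsManifold.maximalAtlas 𝓘(ℝ, E) ∞ M) {x y : E} (h : (x, y) ∈ G.domainCoord e)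
    (u w : E) : G.gCoord e x y u w =
      (1 / 2) * fderiv ℝ (fderiv ℝ (G.lCoord e)) (x, y) (0, u) (0, w) := by
  rw [← deriv2_aux (G.isOpen_domainCoord e he) (G.contDiffOn_lCoord e he) h]
  have hc : ∀ t s : ℝ, G.lCoord e ((x, y) + t • (0, u) + s • (0, w)) =
      G.L ⟨e.symm x, ofCoord e x y + t • ofCoord e x u + s • ofCoord e x w⟩ := fun t s => by
    have : ((x, y) + t • (0, u) + s • (0, w) : E × E) = (x, y + t • u + s • w) := by simp
    rw [this]
    simp only [lCoord, ofCoord_add, ofCoord_smul]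
  simp only [hc]
  rfl

theorem cartanCoord_eq {e : OpenPartialHomeomorph M E}
    (he : e ∈ IsManifold.maximalAtlas 𝓘(ℝ, E) ∞ M) {x y : E} (h : (x, y) ∈ G.domainCoord e)
    (u v w : E) : G.cartanCoord e x y u v w =
      (1 / 4) * fderiv ℝ (fderiv ℝ (fderiv ℝ (G.lCoord e))) (x, y) (0, w) (0, v) (0, u) := by
  rw [← deriv3_aux (G.isOpen_domainCoord e he) (G.contDiffOn_lCoord e he) h]
  have hc : ∀ r t s : ℝ, G.lCoord e ((x, y) + s • (0, u) + t • (0, v) + r • (0, w)) =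
      G.L ⟨e.symm x, ofCoord e x y + s • ofCoord e x u + t • ofCoord e x v +
        r • ofCoord e x w⟩ := fun r t s => by
    have : ((x, y) + s • (0, u) + t • (0, v) + r • (0, w) : E × E) =
      (x, y + s • u + t • v + r • w) := by simp
    rw [this]
    simp only [lCoord, ofCoord_add, ofCoord_smul]
  simp only [hc]
  rfl

theorem fderiv_gCoord {e : OpenPartialHomeomorph M E}
    (he : e ∈ IsManifold.maximalAtlas 𝓘(ℝ, E) ∞ M) {x y : E} (h : (x, y) ∈ G.domainCoord e)
    (X Y Z : E) : fderiv ℝ (fun x' => G.gCoord e x' y Y Z) x X =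
      (1 / 2) * fderiv ℝ (fderiv ℝ (fderiv ℝ (G.lCoord e))) (x, y) (X, 0) (0, Y) (0, Z) := by
  have hU := G.isOpen_domainCoord e he
  have h1 : (fun x' => G.gCoord e x' y Y Z) =ᶠ[nhds x]
      fun x' => (1 / 2) * fderiv ℝ (fderiv ℝ (G.lCoord e)) (x', y) (0, Y) (0, Z) := by
    have : Continuous fun x' : E => (x', y) := by fun_prop
    filter_upwards [this.continuousAt.preimage_mem_nhds (hU.mem_nhds h)] with x' hx'
    exact G.gCoord_eq he hx' Y Z
  rw [h1.fderiv_eq]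
  have h2 := (differentiableAt_aux hU (contDiffOn_fderiv_aux hU (contDiffOn_fderiv_aux hU
    (G.contDiffOn_lCoord e he))) h).hasFDerivAt
  have h3 := HasFDerivAt.comp (f := fun x' : E => (x', y)) x h2
    ((hasFDerivAt_id x).prodMk (hasFDerivAt_const y x))
  have h4 := ((h3.clm_apply (hasFDerivAt_const (0, Y) x)).clm_apply
    (hasFDerivAt_const (0, Z) x)).const_mul (1 / 2 : ℝ)
  exact (congrArg (fun f : E →L[ℝ] ℝ => f X) h4.fderiv).trans (by simp)

theorem euler_aux {e : OpenPartialHomeomorph M E}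
    (he : e ∈ IsManifold.maximalAtlas 𝓘(ℝ, E) ∞ M) {x y : E} (h : (x, y) ∈ G.domainCoord e)
    (u w : E) :
    fderiv ℝ (fderiv ℝ (fderiv ℝ (G.lCoord e))) (x, y) (0, y) (0, u) (0, w) = 0 := by
  have hU := G.isOpen_domainCoord e he
  have hL := G.contDiffOn_lCoord e he
  have hL1 := contDiffOn_fderiv_aux hU hL
  have hL2 := contDiffOn_fderiv_aux hU hL1
  have hmem : ∀ r : ℝ, 0 < r → ∀ q ∈ G.domainCoord e, (q.1, r • q.2) ∈ G.domainCoord e := by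
    intro r hr q hq
    refine ⟨hq.1, ?_⟩
    have := G.conic _ _ r hr hq.2
    rwa [← ofCoord_smul] at this
  let δ : ℝ → (E × E →L[ℝ] E × E) := fun r =>
    (ContinuousLinearMap.fst ℝ E E).prod (r • ContinuousLinearMap.snd ℝ E E)
  have e1 : ∀ r : ℝ, 0 < r → ∀ q ∈ G.domainCoord e,
      fderiv ℝ (G.lCoord e) (δ r q) (0, w) = r * fderiv ℝ (G.lCoord e) q (0, w) := by
    intro r hr q hq
    have a1 : (fun q => G.lCoord e (δ r q)) =ᶠ[nhds q] fun q => r ^ 2 * G.lCoord e q := by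
      filter_upwards [hU.mem_nhds hq] with q' hq'
      have := G.homogeneous _ _ r hr hq'.2
      rw [← ofCoord_smul] at this
      exact this
    have a2 := (differentiableAt_aux hU hL (hmem r hr q hq)).hasFDerivAt.comp q (δ r).hasFDerivAt
    have a3 := ((differentiableAt_aux hU hL hq).hasFDerivAt.const_mul (r ^ 2)).congr_of_eventuallyEq
      a1
    have a4 := congrArg (fun f : E × E →L[ℝ] ℝ => f (0, w)) (a2.unique a3)
    have a5 : δ r (0, w) = r • ((0, w) : E × E) := by simp [δ]
    simp only [ContinuousLinearMap.comp_apply, a5, map_smul, smul_eq_mul,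
      smul_apply] at a4
    have : r * fderiv ℝ (G.lCoord e) (δ r q) (0, w) =
      r * (r * fderiv ℝ (G.lCoord e) q (0, w)) := by
      rw [← mul_assoc, ← pow_two]; exact a4
    exact mul_left_cancel₀ hr.ne' this
  have e2 : ∀ r : ℝ, 0 < r →
      fderiv ℝ (fderiv ℝ (G.lCoord e)) (δ r (x, y)) (0, u) (0, w) =
        fderiv ℝ (fderiv ℝ (G.lCoord e)) (x, y) (0, u) (0, w) := by
    intro r hr
    have a1 : (fun q => fderiv ℝ (G.lCoord e) (δ r q) (0, w)) =ᶠ[nhds (x, y)]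
        fun q => r * fderiv ℝ (G.lCoord e) q (0, w) := by
      filter_upwards [hU.mem_nhds h] with q' hq'
      exact e1 r hr q' hq'
    have a2 := ((differentiableAt_aux hU hL1 (hmem r hr _ h)).hasFDerivAt.comp (x, y)
      (δ r).hasFDerivAt).clm_apply (hasFDerivAt_const (0, w) (x, y))
    have a3 := (((differentiableAt_aux hU hL1 h).hasFDerivAt.clm_apply
      (hasFDerivAt_const (0, w) (x, y))).const_mul r).congr_of_eventuallyEq a1
    have a4 := congrArg (fun f : E × E →L[ℝ] ℝ => f (0, u)) (a2.unique a3)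
    have a5 : δ r (0, u) = r • ((0, u) : E × E) := by simp [δ]
    have hδ : (x, r • y) = δ r (x, y) := rfl
    have a6 : r * fderiv ℝ (fderiv ℝ (G.lCoord e)) (δ r (x, y)) (0, u) (0, w) =
        r * fderiv ℝ (fderiv ℝ (G.lCoord e)) (x, y) (0, u) (0, w) := by
      simpa [a5, -Prod.smul_mk, hδ] using a4
    exact mul_left_cancel₀ hr.ne' a6
  have h1 : (fun t : ℝ => fderiv ℝ (fderiv ℝ (G.lCoord e)) ((x, y) + t • (0, y)) (0, u) (0, w))
      =ᶠ[nhds 0] fun _ => fderiv ℝ (fderiv ℝ (G.lCoord e)) (x, y) (0, u) (0, w) := by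
    filter_upwards [lt_mem_nhds (show (-1 : ℝ) < 0 by norm_num)] with t ht
    rw [← e2 (1 + t) (by linarith)]
    simp [δ, add_smul]
  have h2 := hasDerivAt_line_aux (differentiableAt_aux hU hL2 h) ((0, y) : E × E)
  have h3 := ((h2.clm_apply (hasDerivAt_const (0 : ℝ) ((0, u) : E × E))).clm_apply
    (hasDerivAt_const (0 : ℝ) ((0, w) : E × E))).deriv
  rw [h1.deriv_eq] at h3
  simpa using h3.symm

/-- At every vector of the domain the Chern connection has exactly one system of Christoffel symbols in
a given chart. -/
theorem existsUnique_isChernSymbol [FiniteDimensional ℝ E] {e : OpenPartialHomeomorph M E}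
    (he : e ∈ IsManifold.maximalAtlas 𝓘(ℝ, E) ∞ M) {x y : E} (hx : x ∈ e.target)
    (hy : (⟨e.symm x, ofCoord e x y⟩ : TangentBundle 𝓘(ℝ, E) M) ∈ G.domain) :
    ∃! Γ, G.IsChernSymbol e x y Γ := by
  have h : (x, y) ∈ G.domainCoord e := ⟨hx, hy⟩
  have hU := G.isOpen_domainCoord e he
  have hL := G.contDiffOn_lCoord e he
  have hL1 := contDiffOn_fderiv_aux hU hL
  have hL2 := contDiffOn_fderiv_aux hU hL1
  set H := fderiv ℝ (fderiv ℝ (G.lCoord e)) with hH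
  set T := fderiv ℝ H (x, y) with hT
  have s2 : ∀ q ∈ G.domainCoord e, ∀ u w, H q u w = H q w u := fun q hq u w =>
    (hL.contDiffAt (hU.mem_nhds hq)).isSymmSndFDerivAt (by simp only [minSmoothness_of_isRCLikeNormedField]; exact ENat.LEInfty.out) u w
  have s3 : ∀ u v w, T u v w = T v u w := fun u v w => by
    rw [(hL1.contDiffAt (hU.mem_nhds h)).isSymmSndFDerivAt (by simp only [minSmoothness_of_isRCLikeNormedField]; exact ENat.LEInfty.out) u v]
  have s4 : ∀ u v w, T u v w = T u w v := fun u v w => by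
    have a := (differentiableAt_aux hU hL2 h).hasFDerivAt
    have b := fun v w => (a.clm_apply (hasFDerivAt_const v (x, y))).clm_apply
      (hasFDerivAt_const w (x, y))
    have c : (fun q => H q v w) =ᶠ[nhds (x, y)] fun q => H q w v := by
      filter_upwards [hU.mem_nhds h] with q hq using s2 q hq v w
    have d := congrArg (fun f : E × E →L[ℝ] ℝ => f u)
      ((b v w).unique ((b w v).congr_of_eventuallyEq c))
    simpa using d
  let i := ContinuousLinearMap.inr ℝ E E
  let j := ContinuousLinearMap.inl ℝ E E
  let P : (E × E →L[ℝ] E × E →L[ℝ] ℝ) →L[ℝ] (E →L[ℝ] E →L[ℝ] ℝ) :=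
    (ContinuousLinearMap.postcomp E (ContinuousLinearMap.precomp ℝ i)).comp
      (ContinuousLinearMap.precomp (E × E →L[ℝ] ℝ) i)
  have hP : ∀ B u w, P B u w = B (0, u) (0, w) := fun B u w => rfl
  let g : E →L[ℝ] E →L[ℝ] ℝ := (1 / 2 : ℝ) • P (H (x, y))
  let C : E →L[ℝ] E →L[ℝ] E →L[ℝ] ℝ := (1 / 4 : ℝ) • P.comp (T.comp i)
  let D : E →L[ℝ] E →L[ℝ] E →L[ℝ] ℝ := (1 / 2 : ℝ) • P.comp (T.comp j)
  have hg : ∀ u w, g u w = G.gCoord e x y u w := fun u w => by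
    rw [G.gCoord_eq he h]; rfl
  have hC : ∀ u v w, C u v w = G.cartanCoord e x y u v w := fun u v w => by
    rw [G.cartanCoord_eq he h, ← hH, ← hT, s4, s3, s4]; rfl
  have hD : ∀ u v w, D u v w = fderiv ℝ (fun x' => G.gCoord e x' y v w) x u := fun u v w => by
    rw [G.fderiv_gCoord he h]; rfl
  have key := chernAlg g C D y
    (fun u w => congrArg ((1 / 2 : ℝ) * ·) (s2 _ h (0, u) (0, w)))
    (fun u hu => by
      have hinj : ofCoord e x u = 0 := by
        refine G.nondegenerate _ _ hy _ fun w => ?_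
        obtain ⟨w', rfl⟩ : ∃ w', ofCoord e x w' = w :=
          ((mdifferentiable_of_mem_maximalAtlas_aux e he).symm.mfderiv_surjective hx) w
        exact (hg u w').symm.trans (hu w')
      exact ((mdifferentiable_of_mem_maximalAtlas_aux e he).symm.mfderiv_injective hx)
        (hinj.trans (map_zero _).symm))
    (fun u v w => congrArg ((1 / 4 : ℝ) * ·) (s3 (0, u) (0, v) (0, w)))
    (fun u v w => congrArg ((1 / 4 : ℝ) * ·) (s4 (0, u) (0, v) (0, w)))
    (fun u w => (congrArg ((1 / 4 : ℝ) * ·) (G.euler_aux he h u w)).trans (mul_zero _))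
    (fun u v w => congrArg ((1 / 2 : ℝ) * ·) (s4 (u, 0) (0, v) (0, w)))
  have iff : ∀ Γ, G.IsChernSymbol e x y Γ ↔ ((∀ X Y, Γ X Y = Γ Y X) ∧
      ∀ X Y Z, D X Y Z = g (Γ X Y) Z + g Y (Γ X Z) + 2 * C (Γ X y) Y Z) := by
    intro Γ
    simp only [hg, hC, hD]
    exact ⟨fun h => ⟨h.1, h.2⟩, fun h => ⟨h.1, h.2⟩⟩
  simpa only [iff] using key

open Classical in
/-- The Christoffel symbols of the Chern connection in the chart `e`, as a function of the
coordinates `(x, y)` of a vector of the domain, where they exist and are unique by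
`existsUnique_isChernSymbol` (junk value `0` elsewhere). -/
noncomputable def christoffel (e : OpenPartialHomeomorph M E) (x y : E) : E →L[ℝ] E →L[ℝ] E :=
  if h : ∃ Γ, G.IsChernSymbol e x y Γ then h.choose else 0

/-- The coordinate expression `Ẋᵏ + ∑ Γᵏᵢⱼ(W) Xⁱ ċʲ` of the covariant derivative `D^W_c X` of `X`
along `c` with reference field `W`; all data are given by their coordinates in the chart `e`, and
`S` is the interval of definition. -/
noncomputable def covDerivCoord (e : OpenPartialHomeomorph M E) (S : Set ℝ) (c W X : ℝ → E)
    (t : ℝ) : E :=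
  derivWithin X S t + G.christoffel e (c t) (W t) (X t) (derivWithin c S t)

/-- The covariant derivative `D^{γ̇}_γ X` of a vector field along `γ : S → M`, at the instant `t`. -/
noncomputable def covDeriv (S : Set ℝ) (γ : ℝ → M) (X : ∀ t, TangentSpace 𝓘(ℝ, E) (γ t)) (t : ℝ) :
    TangentSpace 𝓘(ℝ, E) (γ t) :=
  (mfderiv 𝓘(ℝ, E) 𝓘(ℝ, E) (chartAt E (γ t)) (γ t)).inverse
    (G.covDerivCoord (chartAt E (γ t)) S (chartAt E (γ t) ∘ γ)
      (coordField (chartAt E (γ t)) γ (velocity S γ)) (coordField (chartAt E (γ t)) γ X) t)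

/-- A geodesic `γ : [a, b] → M`: a smooth curve whose velocity stays in the domain of the metric and
is parallel, `D^{γ̇}_γ γ̇ = 0` in every chart. -/
structure IsGeodesic (a b : ℝ) (γ : ℝ → M) : Prop where
  smooth : ContMDiffOn 𝓘(ℝ, ℝ) 𝓘(ℝ, E) ∞ γ (Icc a b)
  admissible : ∀ t ∈ Icc a b,
    (⟨γ t, velocity (Icc a b) γ t⟩ : TangentBundle 𝓘(ℝ, E) M) ∈ G.domain
  parallel : ∀ e ∈ IsManifold.maximalAtlas 𝓘(ℝ, E) ∞ M, ∀ t ∈ Icc a b, γ t ∈ e.source →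
    G.covDerivCoord e (Icc a b) (e ∘ γ) (coordField e γ (velocity (Icc a b) γ))
      (coordField e γ (velocity (Icc a b) γ)) t = 0

/-- For a two-parameter map `Λ(t, s)` and a vector field `Z(t, s)` along it, both in the
coordinates of the chart `e`: the coordinates of
`R^Λ(Z) = D_{γ_s} D_{β_t} Z - D_{β_t} D_{γ_s} Z`, where `γ_s = Λ(·, s)`, `β_t = Λ(t, ·)` and all
covariant derivatives have reference field `Λ_t = ∂Λ/∂t`. -/
noncomputable def curvatureCoord (e : OpenPartialHomeomorph M E) (S : Set ℝ) (Λ Z : ℝ → ℝ → E)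
    (t s : ℝ) : E :=
  let T : ℝ → ℝ → E := fun t s => derivWithin (fun τ => Λ τ s) S t
  let Dγ : (ℝ → ℝ → E) → ℝ → ℝ → E := fun Y t s =>
    G.covDerivCoord e S (fun τ => Λ τ s) (fun τ => T τ s) (fun τ => Y τ s) t
  let Dβ : (ℝ → ℝ → E) → ℝ → ℝ → E := fun Y t s =>
    G.covDerivCoord e univ (fun σ => Λ t σ) (fun σ => T t σ) (fun σ => Y t σ) s
  Dγ (Dβ Z) t s - Dβ (Dγ Z) t s

/-- The coordinates in the chart `e` of `R^γ(γ̇, W) Z := R^Λ(Z̃)` at the instant `t`, where `Λ` is a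
variation of `γ` with variational vector field `W` and `Z̃` extends `Z` to `Λ`. The result does not
depend on the choice of `Λ` and `Z̃`; in the coordinates of `e` we take `Λ(τ, s) = γ(τ) + s W(τ)`,
which is a variation through curves admissible near `t` for small `s`, and `Z̃(τ, s) = Z(τ)`. -/
noncomputable def jacobiOperatorCoord (e : OpenPartialHomeomorph M E) (S : Set ℝ) (γ : ℝ → M)
    (W Z : ∀ t, TangentSpace 𝓘(ℝ, E) (γ t)) (t : ℝ) : E :=
  G.curvatureCoord e S (fun τ s => e (γ τ) + s • coordField e γ W τ)
    (fun τ _ => coordField e γ Z τ) t 0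

/-- A Jacobi field along `γ : [a, b] → M`: a smooth vector field `J` along `γ` satisfying
`J'' = R^γ(γ̇, J) γ̇`, where `J' = D^{γ̇}_γ J`, in every chart. -/
structure IsJacobiField (a b : ℝ) (γ : ℝ → M) (J : ∀ t, TangentSpace 𝓘(ℝ, E) (γ t)) : Prop where
  smooth : ContMDiffOn 𝓘(ℝ, ℝ) 𝓘(ℝ, E).tangent ∞
    (fun t => (⟨γ t, J t⟩ : TangentBundle 𝓘(ℝ, E) M)) (Icc a b)
  equation : ∀ e ∈ IsManifold.maximalAtlas 𝓘(ℝ, E) ∞ M, ∀ t ∈ Icc a b, γ t ∈ e.source →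
    G.covDerivCoord e (Icc a b) (e ∘ γ) (coordField e γ (velocity (Icc a b) γ))
      (G.covDerivCoord e (Icc a b) (e ∘ γ) (coordField e γ (velocity (Icc a b) γ))
        (coordField e γ J)) t =
    G.jacobiOperatorCoord e (Icc a b) γ J (velocity (Icc a b) γ) t

/-- The projection of `Y` onto `span(γ̇)` in the decomposition of the tangent spaces along `γ` into
`span(γ̇)` and its `g_γ̇`-orthogonal complement (for `g_γ̇(γ̇, γ̇) = L(γ̇) ≠ 0`). -/
noncomputable def tanPart (S : Set ℝ) (γ : ℝ → M) (Y : ∀ t, TangentSpace 𝓘(ℝ, E) (γ t)) (t : ℝ) :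
    TangentSpace 𝓘(ℝ, E) (γ t) :=
  (fundamentalTensor G.L (velocity S γ t) (velocity S γ t) (Y t) /
    fundamentalTensor G.L (velocity S γ t) (velocity S γ t) (velocity S γ t)) • velocity S γ t

/-- The projection of `Y` onto the `g_γ̇`-orthogonal complement of `γ̇` in the same decomposition. -/
noncomputable def norPart (S : Set ℝ) (γ : ℝ → M) (Y : ∀ t, TangentSpace 𝓘(ℝ, E) (γ t)) (t : ℝ) :
    TangentSpace 𝓘(ℝ, E) (γ t) :=
  Y t - G.tanPart S γ Y t

end

end PseudoFinslerMetric

/-! Everything is carried to a chart, where `L` becomes a function of `q = (x, y)`, the fundamental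
tensor is half its fibre Hessian, and a geodesic solves x'' + S(x, x') = 0 with the spray S(x, y) =
Γ(x, y)(y, y). The crucial point is that the Jacobi equation is the linearization of this equation:
in coordinates Y of `J` it reads Y'' + dS(Y, Y') = 0 (`IsGeodesic.jacobi_equation_iff`). Curvature
never appears again.

Part (i) comes from homogeneity. Euler's relation dS(0, y) = 2S makes the linearized operator send f
γ̇ to f'' γ̇ (`IsGeodesic.linearized_smul_velocity`), so tangent Jacobi fields are exactly the
affine multiples of γ̇.

Part (ii) comes from conservation of `L`. The horizontal lift (y, -S) annihilates `L`
(`fderiv_lCoord_spray`); linearizing this identity shows that ½ dL(Y, Y') is constant along a Jacobi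
field. Since g_γ̇(γ̇, ·) = ½ dL(0, ·) by Euler, that quantity is at once g_γ̇(γ̇, J') and the
derivative of g_γ̇(γ̇, J). Hence g_γ̇(γ̇, J) is affine in t with slope g_γ̇(γ̇, J')
(`IsGeodesic.fundamentalTensor_jacobi_eq`), and the equivalences concern the zeros of an affine
function.

Part (iii) follows: g_γ̇(γ̇, γ̇) = L(γ̇) is constant, so the tangent part of a Jacobi field is an
affine multiple of γ̇, hence Jacobi, and Jacobi fields form a vector space.

Differentiating S requires smooth Christoffel symbols, although these are given only by existence
and uniqueness. Smoothness is bootstrapped from the Koszul formula (`contDiffOn_christoffel`). -/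

/-! ### Symmetry of iterated derivatives; smoothness of implicitly defined vectors. -/

section

variable {V : Type*} [NormedAddCommGroup V] [NormedSpace ℝ V] {F : V → ℝ} {U : Set V}

theorem fderiv_fderiv_symm_of_contDiffOn {W : Type*} [NormedAddCommGroup W] [NormedSpace ℝ W]
    {f : V → W} (hU : IsOpen U) (hf : ContDiffOn ℝ ∞ f U) {q : V} (hq : q ∈ U) (u w : V) :
    fderiv ℝ (fderiv ℝ f) q u w = fderiv ℝ (fderiv ℝ f) q w u :=
  (hf.contDiffAt (hU.mem_nhds hq)).isSymmSndFDerivAt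
    (by simp only [minSmoothness_of_isRCLikeNormedField]; exact ENat.LEInfty.out) u w

theorem hasFDerivAt_fderiv_of_contDiffOn {W : Type*} [NormedAddCommGroup W] [NormedSpace ℝ W]
    {f : V → W} (hU : IsOpen U) (hf : ContDiffOn ℝ ∞ f U) {q : V} (hq : q ∈ U) :
    HasFDerivAt f (fderiv ℝ f q) q :=
  (differentiableAt_aux hU hf hq).hasFDerivAt

/-- With `fderiv_three_symm_right` this makes the third derivative totally symmetric, so that a
fibre vector `(0, q.2)` can be moved from any slot into the one where Euler's relation applies. -/
theorem fderiv_three_symm_left (hU : IsOpen U) (hF : ContDiffOn ℝ ∞ F U) {q : V} (hq : q ∈ U)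
    (u v w : V) : fderiv ℝ (fderiv ℝ (fderiv ℝ F)) q u v w =
      fderiv ℝ (fderiv ℝ (fderiv ℝ F)) q v u w := by
  rw [fderiv_fderiv_symm_of_contDiffOn hU (contDiffOn_fderiv_aux hU hF) hq u v]

theorem fderiv_three_symm_right (hU : IsOpen U) (hF : ContDiffOn ℝ ∞ F U) {q : V} (hq : q ∈ U)
    (u v w : V) : fderiv ℝ (fderiv ℝ (fderiv ℝ F)) q u v w =
      fderiv ℝ (fderiv ℝ (fderiv ℝ F)) q u w v := by
  have a := hasFDerivAt_fderiv_of_contDiffOn hU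
    (contDiffOn_fderiv_aux hU (contDiffOn_fderiv_aux hU hF)) hq
  have b := fun v w => (a.clm_apply (hasFDerivAt_const v q)).clm_apply (hasFDerivAt_const w q)
  have c : (fun q => fderiv ℝ (fderiv ℝ F) q v w) =ᶠ[nhds q]
      fun q => fderiv ℝ (fderiv ℝ F) q w v := by
    filter_upwards [hU.mem_nhds hq] with q hq
    exact fderiv_fderiv_symm_of_contDiffOn hU hF hq v w
  have d := congrArg (fun f : V →L[ℝ] ℝ => f u)
    ((b v w).unique ((b w v).congr_of_eventuallyEq c))
  simpa using d

/-- A vector-valued function defined implicitly by a smooth nondegenerate bilinear form is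
smooth. -/
theorem contDiffOn_of_bilin_eq {X E : Type*} [NormedAddCommGroup X] [NormedSpace ℝ X]
    [NormedAddCommGroup E] [NormedSpace ℝ E] [FiniteDimensional ℝ E] {s : Set X}
    {B : X → E →L[ℝ] E →L[ℝ] ℝ} (hB : ContDiffOn ℝ ∞ B s)
    (hn : ∀ x ∈ s, ∀ u, (∀ w, B x u w = 0) → u = 0) {f : X → E}
    (hf : ∀ z, ContDiffOn ℝ ∞ (fun x => B x (f x) z) s) : ContDiffOn ℝ ∞ f s := by
  have := FiniteDimensional.complete ℝ E
  have h1 : ContDiffOn ℝ ∞ (fun x => B x (f x)) s := contDiffOn_clm_apply.2 hf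
  -- Pointwise f = B⁻¹(B f). In finite dimension nondegeneracy makes `B x` invertible, and inversion
  -- is smooth at invertible maps.
  have h2 : ∀ x ∈ s, ∃ A : E ≃L[ℝ] (E →L[ℝ] ℝ), (A : E →L[ℝ] E →L[ℝ] ℝ) = B x := by
    intro x hx
    have inj : Function.Injective (B x : E →ₗ[ℝ] (E →L[ℝ] ℝ)) := by
      rw [injective_iff_map_eq_zero]
      intro u hu
      exact hn x hx u fun w => by simpa using congrArg (fun f : E →L[ℝ] ℝ => f w) hu
    have hd : Module.finrank ℝ E = Module.finrank ℝ (E →L[ℝ] ℝ) := by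
      rw [← (LinearMap.toContinuousLinearMap (𝕜 := ℝ) (E := E) (F' := ℝ)).finrank_eq]
      exact (Subspace.dual_finrank_eq (K := ℝ) (V := E)).symm
    refine ⟨(LinearEquiv.ofInjectiveOfFinrankEq _ inj hd).toContinuousLinearEquiv, ?_⟩
    ext u w
    rfl
  have h3 : ContDiffOn ℝ ∞ (fun x => (B x).inverse) s := by
    intro x hx
    obtain ⟨A, hA⟩ := h2 x hx
    have := contDiffAt_map_inverse (𝕜 := ℝ) (n := ∞) A
    rw [hA] at this
    exact this.comp_contDiffWithinAt x (hB x hx)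
  refine (h3.clm_apply h1).congr fun x hx => ?_
  obtain ⟨A, hA⟩ := h2 x hx
  rw [← hA, ContinuousLinearMap.inverse_equiv]
  simp

end

/-! ### Derivatives of Euler's relation for functions of degree two in the fibre. -/

section

variable {E : Type*} [NormedAddCommGroup E] [NormedSpace ℝ E] {L : E × E → ℝ} {U : Set (E × E)}

theorem hasFDerivAt_fiber (q : E × E) :
    HasFDerivAt (fun q : E × E => ((0, q.2) : E × E))
      ((0 : E × E →L[ℝ] E).prod (ContinuousLinearMap.snd ℝ E E)) q :=
  ((0 : E × E →L[ℝ] E).prod (ContinuousLinearMap.snd ℝ E E)).hasFDerivAt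

/-- First derivative of Euler's relation for a function of degree two. -/
theorem euler_fderiv (hU : IsOpen U) (hL : ContDiffOn ℝ ∞ L U)
    (h : ∀ q ∈ U, fderiv ℝ L q (0, q.2) = 2 * L q) {q : E × E} (hq : q ∈ U) (ξ : E × E) :
    fderiv ℝ (fderiv ℝ L) q ξ (0, q.2) = 2 * fderiv ℝ L q ξ - fderiv ℝ L q (0, ξ.2) := by
  have a := (hasFDerivAt_fderiv_of_contDiffOn hU (contDiffOn_fderiv_aux hU hL) hq).clm_apply
    (hasFDerivAt_fiber q)
  have b := (hasFDerivAt_fderiv_of_contDiffOn hU hL hq).const_mul 2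
  have c : (fun q : E × E => fderiv ℝ L q (0, q.2)) =ᶠ[nhds q] fun q => 2 * L q := by
    filter_upwards [hU.mem_nhds hq] with q hq using h q hq
  have d := congrArg (fun f : E × E →L[ℝ] ℝ => f ξ) (a.unique (b.congr_of_eventuallyEq c))
  simp at d
  linarith

/-- Second derivative of Euler's relation for a function of degree two. -/
theorem euler_fderiv_fderiv (hU : IsOpen U) (hL : ContDiffOn ℝ ∞ L U)
    (h : ∀ q ∈ U, fderiv ℝ L q (0, q.2) = 2 * L q) {q : E × E} (hq : q ∈ U) (ζ ξ : E × E) :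
    fderiv ℝ (fderiv ℝ (fderiv ℝ L)) q ζ ξ (0, q.2) = 2 * fderiv ℝ (fderiv ℝ L) q ζ ξ -
      fderiv ℝ (fderiv ℝ L) q ζ (0, ξ.2) - fderiv ℝ (fderiv ℝ L) q ξ (0, ζ.2) := by
  have hL1 := contDiffOn_fderiv_aux hU hL
  have a := ((hasFDerivAt_fderiv_of_contDiffOn hU (contDiffOn_fderiv_aux hU hL1) hq).clm_apply
    (hasFDerivAt_const ξ q)).clm_apply (hasFDerivAt_fiber q)
  have b := fun ξ => (hasFDerivAt_fderiv_of_contDiffOn hU hL1 hq).clm_apply (hasFDerivAt_const ξ q)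
  have b' := ((b ξ).const_mul 2).sub (b (0, ξ.2))
  have c : (fun q : E × E => fderiv ℝ (fderiv ℝ L) q ξ (0, q.2)) =ᶠ[nhds q]
      fun q => 2 * fderiv ℝ L q ξ - fderiv ℝ L q (0, ξ.2) := by
    filter_upwards [hU.mem_nhds hq] with q hq using euler_fderiv hU hL h hq ξ
  have d := congrArg (fun f : E × E →L[ℝ] ℝ => f ζ) (a.unique (b'.congr_of_eventuallyEq c))
  simp at d
  linarith

end

/-! ### Christoffel symbols and spray in a chart: identities, smoothness, homogeneity. -/

namespace PseudoFinslerMetric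

section

variable {E : Type*} [NormedAddCommGroup E] [NormedSpace ℝ E]
  {M : Type*} [TopologicalSpace M] [ChartedSpace E M] [IsManifold 𝓘(ℝ, E) ∞ M]
  (G : PseudoFinslerMetric E M) {e : OpenPartialHomeomorph M E}

/-- Derivative of L((1 + t) v) = (1 + t)² L(v) at t = 0. -/
theorem fderiv_lCoord_fiber (he : e ∈ IsManifold.maximalAtlas 𝓘(ℝ, E) ∞ M) {q : E × E}
    (hq : q ∈ G.domainCoord e) : fderiv ℝ (G.lCoord e) q (0, q.2) = 2 * G.lCoord e q := by
  have a := (hasDerivAt_line_aux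
    (differentiableAt_aux (G.isOpen_domainCoord e he) (G.contDiffOn_lCoord e he) hq) (0, q.2))
  have b : HasDerivAt (fun t : ℝ => (1 + t) ^ 2 * G.lCoord e q) (2 * G.lCoord e q) 0 := by
    have := (((hasDerivAt_id (0 : ℝ)).const_add 1).pow 2).mul_const (G.lCoord e q)
    simpa using this
  refine a.unique (b.congr_of_eventuallyEq ?_)
  filter_upwards [lt_mem_nhds (show (-1 : ℝ) < 0 by norm_num)] with t ht
  have h1 := G.homogeneous _ _ (1 + t) (by linarith) hq.2
  rw [← ofCoord_smul] at h1
  have h2 : q + t • (0, q.2) = (q.1, (1 + t) • q.2) := by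
    ext <;> simp [add_smul]
  rw [h2]
  exact h1

theorem fderiv_fderiv_lCoord_nondegenerate (he : e ∈ IsManifold.maximalAtlas 𝓘(ℝ, E) ∞ M)
    {q : E × E} (hq : q ∈ G.domainCoord e) (u : E)
    (hu : ∀ w, fderiv ℝ (fderiv ℝ (G.lCoord e)) q (0, u) (0, w) = 0) : u = 0 := by
  have hd := (mdifferentiable_of_mem_maximalAtlas_aux e he).symm
  have hinj : ofCoord e q.1 u = 0 := by
    refine G.nondegenerate _ _ hq.2 _ fun w => ?_
    obtain ⟨w', rfl⟩ : ∃ w', ofCoord e q.1 w' = w := (hd.mfderiv_surjective hq.1) w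
    exact (G.gCoord_eq he hq u w').trans (by rw [hu, mul_zero])
  exact (hd.mfderiv_injective hq.1) (hinj.trans (map_zero _).symm)

section

variable [FiniteDimensional ℝ E]

theorem isChernSymbol_christoffel (he : e ∈ IsManifold.maximalAtlas 𝓘(ℝ, E) ∞ M) {q : E × E}
    (hq : q ∈ G.domainCoord e) : G.IsChernSymbol e q.1 q.2 (G.christoffel e q.1 q.2) := by
  have h := (G.existsUnique_isChernSymbol he hq.1 hq.2).exists
  rw [christoffel, dif_pos h]
  exact h.choose_spec

theorem christoffel_symm (he : e ∈ IsManifold.maximalAtlas 𝓘(ℝ, E) ∞ M) {q : E × E}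
    (hq : q ∈ G.domainCoord e) (X Y : E) :
    G.christoffel e q.1 q.2 X Y = G.christoffel e q.1 q.2 Y X :=
  (G.isChernSymbol_christoffel he hq).torsionFree X Y

/-- Almost compatibility multiplied by 2: since g = ½ D²L and C = ¼ D³L, all coefficients become 1.
-/
theorem christoffel_compatible (he : e ∈ IsManifold.maximalAtlas 𝓘(ℝ, E) ∞ M) {q : E × E}
    (hq : q ∈ G.domainCoord e) (X Y Z : E) :
    fderiv ℝ (fderiv ℝ (fderiv ℝ (G.lCoord e))) q (X, 0) (0, Y) (0, Z) =
      fderiv ℝ (fderiv ℝ (G.lCoord e)) q (0, G.christoffel e q.1 q.2 X Y) (0, Z) +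
      fderiv ℝ (fderiv ℝ (G.lCoord e)) q (0, G.christoffel e q.1 q.2 X Z) (0, Y) +
      fderiv ℝ (fderiv ℝ (fderiv ℝ (G.lCoord e))) q (0, Z) (0, Y)
        (0, G.christoffel e q.1 q.2 X q.2) := by
  have h := (G.isChernSymbol_christoffel he hq).compatible X Y Z
  rw [G.fderiv_gCoord he hq, G.gCoord_eq he hq, G.gCoord_eq he hq, G.cartanCoord_eq he hq,
    fderiv_fderiv_symm_of_contDiffOn (G.isOpen_domainCoord e he) (G.contDiffOn_lCoord e he) hq
      (0, Y)] at h
  linarith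

/-- The derivative of `L` along horizontal vectors vanishes. -/
theorem fderiv_lCoord_horizontal (he : e ∈ IsManifold.maximalAtlas 𝓘(ℝ, E) ∞ M) {q : E × E}
    (hq : q ∈ G.domainCoord e) (X : E) :
    fderiv ℝ (G.lCoord e) q (0, G.christoffel e q.1 q.2 X q.2) =
      fderiv ℝ (G.lCoord e) q (X, 0) := by
  have hU := G.isOpen_domainCoord e he
  have hL := G.contDiffOn_lCoord e he
  have hE := fun q hq => G.fderiv_lCoord_fiber he (q := q) hq
  -- With both arguments equal to y the Cartan term vanishes, and Euler's relations reduce the other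
  -- terms to 2 dL(X, 0) = 2 dL(0, Γ(X, y)).
  have h := G.christoffel_compatible he hq X q.2 q.2
  have h1 := euler_fderiv_fderiv hU hL hE hq (X, 0) (0, q.2)
  have h2 := euler_fderiv hU hL hE hq (X, 0)
  have h3 := euler_fderiv hU hL hE hq (0, G.christoffel e q.1 q.2 X q.2)
  have h4 := G.euler_aux he hq q.2 (G.christoffel e q.1 q.2 X q.2)
  simp only [Prod.mk_zero_zero, map_zero] at h1 h2 h3
  linarith

/-- The spray coefficients `Γ(x, y)(y, y)` of the Chern connection. -/
noncomputable def spray (e : OpenPartialHomeomorph M E) (q : E × E) : E :=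
  G.christoffel e q.1 q.2 q.2 q.2

/-- The spray satisfies the Euler-Lagrange equations of `L`. -/
theorem fderiv_fderiv_lCoord_spray (he : e ∈ IsManifold.maximalAtlas 𝓘(ℝ, E) ∞ M) {q : E × E}
    (hq : q ∈ G.domainCoord e) (Z : E) :
    fderiv ℝ (fderiv ℝ (G.lCoord e)) q (0, G.spray e q) (0, Z) =
      fderiv ℝ (fderiv ℝ (G.lCoord e)) q (q.2, 0) (0, Z) - fderiv ℝ (G.lCoord e) q (Z, 0) := by
  have hU := G.isOpen_domainCoord e he
  have hL := G.contDiffOn_lCoord e he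
  have hE := fun q hq => G.fderiv_lCoord_fiber he (q := q) hq
  -- The Cartan term contains y and vanishes. Torsion-freeness turns Γ(y, Z) into Γ(Z, y), whose
  -- pairing with y is dL(Z, 0) by horizontality.
  have h := G.christoffel_compatible he hq q.2 q.2 Z
  rw [fderiv_three_symm_right hU hL hq, fderiv_three_symm_left hU hL hq (0, Z),
    G.euler_aux he hq, G.christoffel_symm he hq q.2 Z] at h
  have h1 := euler_fderiv_fderiv hU hL hE hq (q.2, 0) (0, Z)
  have h3 := euler_fderiv hU hL hE hq (0, G.christoffel e q.1 q.2 Z q.2)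
  have h4 := G.fderiv_lCoord_horizontal he hq Z
  simp only [Prod.mk_zero_zero, map_zero] at h1 h3
  rw [spray]
  linarith

/-- The geodesic spray preserves `L`. -/
theorem fderiv_lCoord_spray (he : e ∈ IsManifold.maximalAtlas 𝓘(ℝ, E) ∞ M) {q : E × E}
    (hq : q ∈ G.domainCoord e) : fderiv ℝ (G.lCoord e) q (q.2, -G.spray e q) = 0 := by
  have h : ((q.2, -G.spray e q) : E × E) = (q.2, 0) - (0, G.spray e q) := by simp
  rw [h, map_sub, spray, G.fderiv_lCoord_horizontal he hq, sub_self]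

/-- Koszul formula for the Christoffel symbols. -/
theorem christoffel_koszul (he : e ∈ IsManifold.maximalAtlas 𝓘(ℝ, E) ∞ M) {q : E × E}
    (hq : q ∈ G.domainCoord e) (X Y Z : E) :
    2 * fderiv ℝ (fderiv ℝ (G.lCoord e)) q (0, G.christoffel e q.1 q.2 X Y) (0, Z) =
      fderiv ℝ (fderiv ℝ (fderiv ℝ (G.lCoord e))) q (X, 0) (0, Y) (0, Z) +
      fderiv ℝ (fderiv ℝ (fderiv ℝ (G.lCoord e))) q (Y, 0) (0, X) (0, Z) -
      fderiv ℝ (fderiv ℝ (fderiv ℝ (G.lCoord e))) q (Z, 0) (0, X) (0, Y) -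
      fderiv ℝ (fderiv ℝ (fderiv ℝ (G.lCoord e))) q (0, Y) (0, Z)
        (0, G.christoffel e q.1 q.2 X q.2) -
      fderiv ℝ (fderiv ℝ (fderiv ℝ (G.lCoord e))) q (0, X) (0, Z)
        (0, G.christoffel e q.1 q.2 Y q.2) +
      fderiv ℝ (fderiv ℝ (fderiv ℝ (G.lCoord e))) q (0, X) (0, Y)
        (0, G.christoffel e q.1 q.2 Z q.2) := by
  have hU := G.isOpen_domainCoord e he
  have hL := G.contDiffOn_lCoord e he
  rw [G.christoffel_compatible he hq X Y Z, G.christoffel_compatible he hq Y X Z,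
    G.christoffel_compatible he hq Z X Y, G.christoffel_symm he hq Y X,
    G.christoffel_symm he hq Z X, G.christoffel_symm he hq Z Y,
    fderiv_three_symm_left hU hL hq (0, Z) (0, Y), fderiv_three_symm_left hU hL hq (0, Z) (0, X),
    fderiv_three_symm_left hU hL hq (0, Y) (0, X)]
  ring

theorem contDiffOn_of_lCoord_bilin (he : e ∈ IsManifold.maximalAtlas 𝓘(ℝ, E) ∞ M) {f : E × E → E}
    (hf : ∀ z, ContDiffOn ℝ ∞ (fun q => fderiv ℝ (fderiv ℝ (G.lCoord e)) q (0, f q) (0, z))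
      (G.domainCoord e)) : ContDiffOn ℝ ∞ f (G.domainCoord e) := by
  have hL2 := contDiffOn_fderiv_aux (G.isOpen_domainCoord e he)
    (contDiffOn_fderiv_aux (G.isOpen_domainCoord e he) (G.contDiffOn_lCoord e he))
  let i := ContinuousLinearMap.inr ℝ E E
  let P : (E × E →L[ℝ] E × E →L[ℝ] ℝ) →L[ℝ] (E →L[ℝ] E →L[ℝ] ℝ) :=
    (ContinuousLinearMap.postcomp E (ContinuousLinearMap.precomp ℝ i)).comp
      (ContinuousLinearMap.precomp (E × E →L[ℝ] ℝ) i)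
  exact contDiffOn_of_bilin_eq (B := fun q => P (fderiv ℝ (fderiv ℝ (G.lCoord e)) q))
    (contDiffOn_clm_apply.2 fun u => contDiffOn_clm_apply.2 fun w =>
      (hL2.clm_apply (contDiffOn_const (c := ((0, u) : E × E)))).clm_apply
        (contDiffOn_const (c := ((0, w) : E × E))))
    (fun q hq u hu => G.fderiv_fderiv_lCoord_nondegenerate he hq u hu) hf

theorem contDiffOn_spray (he : e ∈ IsManifold.maximalAtlas 𝓘(ℝ, E) ∞ M) :
    ContDiffOn ℝ ∞ (G.spray e) (G.domainCoord e) := by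
  have hU := G.isOpen_domainCoord e he
  have hL1 := contDiffOn_fderiv_aux hU (G.contDiffOn_lCoord e he)
  have hL2 := contDiffOn_fderiv_aux hU hL1
  refine G.contDiffOn_of_lCoord_bilin he fun z => ?_
  refine ContDiffOn.congr ?_ fun q hq => G.fderiv_fderiv_lCoord_spray he hq z
  exact ((hL2.clm_apply (by fun_prop)).clm_apply contDiffOn_const).sub
    (hL1.clm_apply contDiffOn_const)

/-- In the Koszul formula the only terms not known to be smooth are the three Cartan terms
containing Γ(·, y). The hypothesis `h` isolates them, so that the lemma can serve twice in a
bootstrap. -/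
theorem contDiffOn_christoffel_apply (he : e ∈ IsManifold.maximalAtlas 𝓘(ℝ, E) ∞ M) (X : E)
    {f : E × E → E} (hf : ContDiffOn ℝ ∞ f (G.domainCoord e))
    (h : ∀ Z, ContDiffOn ℝ ∞ (fun q =>
      fderiv ℝ (fderiv ℝ (fderiv ℝ (G.lCoord e))) q (0, f q) (0, Z)
        (0, G.christoffel e q.1 q.2 X q.2) +
      fderiv ℝ (fderiv ℝ (fderiv ℝ (G.lCoord e))) q (0, X) (0, Z)
        (0, G.christoffel e q.1 q.2 (f q) q.2) -
      fderiv ℝ (fderiv ℝ (fderiv ℝ (G.lCoord e))) q (0, X) (0, f q)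
        (0, G.christoffel e q.1 q.2 Z q.2)) (G.domainCoord e)) :
    ContDiffOn ℝ ∞ (fun q => G.christoffel e q.1 q.2 X (f q)) (G.domainCoord e) := by
  have hU := G.isOpen_domainCoord e he
  have hL3 := contDiffOn_fderiv_aux hU (contDiffOn_fderiv_aux hU
    (contDiffOn_fderiv_aux hU (G.contDiffOn_lCoord e he)))
  refine G.contDiffOn_of_lCoord_bilin he fun Z => ?_
  have c : ∀ u : E × E, ContDiffOn ℝ ∞ (fun _ : E × E => u) (G.domainCoord e) :=
    fun u => contDiffOn_const
  have z : ContDiffOn ℝ ∞ (fun _ : E × E => (0 : E)) (G.domainCoord e) := contDiffOn_const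
  refine ContDiffOn.congr (((((((hL3.clm_apply (c (X, 0))).clm_apply (z.prodMk hf)).clm_apply
    (c (0, Z))).add (((hL3.clm_apply (hf.prodMk z)).clm_apply (c (0, X))).clm_apply
    (c (0, Z)))).sub (((hL3.clm_apply (c (Z, 0))).clm_apply (c (0, X))).clm_apply
    (z.prodMk hf))).sub (h Z)).const_smul (1 / 2 : ℝ)) fun q hq => ?_
  have := G.christoffel_koszul he hq X (f q) Z
  simp only [smul_eq_mul]
  linarith

/-- The Christoffel symbols of the Chern connection are smooth. -/
theorem contDiffOn_christoffel (he : e ∈ IsManifold.maximalAtlas 𝓘(ℝ, E) ∞ M) :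
    ContDiffOn ℝ ∞ (fun q : E × E => G.christoffel e q.1 q.2) (G.domainCoord e) := by
  have hU := G.isOpen_domainCoord e he
  have hL := G.contDiffOn_lCoord e he
  have hL3 := contDiffOn_fderiv_aux hU (contDiffOn_fderiv_aux hU (contDiffOn_fderiv_aux hU hL))
  have c : ∀ u : E × E, ContDiffOn ℝ ∞ (fun _ : E × E => u) (G.domainCoord e) :=
    fun u => contDiffOn_const
  have z : ContDiffOn ℝ ∞ (fun _ : E × E => (0 : E)) (G.domainCoord e) := contDiffOn_const
  -- For f(q) = y two of the Cartan terms vanish and the third contains only the spray, which is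
  -- smooth by the Euler-Lagrange formula. Once Γ(X, y) is smooth, the same lemma applies to
  -- constant Y.
  have h1 : ∀ X, ContDiffOn ℝ ∞ (fun q => G.christoffel e q.1 q.2 X q.2) (G.domainCoord e) := by
    intro X
    refine G.contDiffOn_christoffel_apply he X contDiffOn_snd fun Z => ?_
    refine ContDiffOn.congr (((hL3.clm_apply (c (0, X))).clm_apply (c (0, Z))).clm_apply
      (z.prodMk (G.contDiffOn_spray he))) fun q hq => ?_
    rw [G.euler_aux he hq, fderiv_three_symm_left hU hL hq (0, X) (0, q.2), G.euler_aux he hq,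
      spray]
    ring
  refine contDiffOn_clm_apply.2 fun X => contDiffOn_clm_apply.2 fun Y => ?_
  refine G.contDiffOn_christoffel_apply he X contDiffOn_const fun Z => ?_
  exact (((hL3.clm_apply (c (0, Y))).clm_apply (c (0, Z))).clm_apply (z.prodMk (h1 X))).add
    (((hL3.clm_apply (c (0, X))).clm_apply (c (0, Z))).clm_apply (z.prodMk (h1 Y))) |>.sub
    (((hL3.clm_apply (c (0, X))).clm_apply (c (0, Y))).clm_apply (z.prodMk (h1 Z)))

/-- Euler's relation for the spray, which is homogeneous of degree two. -/
theorem fderiv_spray_fiber (he : e ∈ IsManifold.maximalAtlas 𝓘(ℝ, E) ∞ M) {q : E × E}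
    (hq : q ∈ G.domainCoord e) :
    fderiv ℝ (G.spray e) q (0, q.2) = (2 : ℝ) • G.spray e q := by
  have hU := G.isOpen_domainCoord e he
  have hL := G.contDiffOn_lCoord e he
  have hL1 := contDiffOn_fderiv_aux hU hL
  have hE := fun q hq => G.fderiv_lCoord_fiber he (q := q) hq
  -- Homogeneity of the spray is extracted from the Euler-Lagrange formula: differentiate it in the
  -- direction `(0, q.2)`, simplify with Euler's relations for `L`, and cancel the nondegenerate
  -- Hessian.
  rw [← sub_eq_zero]
  refine G.fderiv_fderiv_lCoord_nondegenerate he hq _ fun Z => ?_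
  have h1 := hasFDerivAt_fderiv_of_contDiffOn hU hL1 hq
  have h2 := hasFDerivAt_fderiv_of_contDiffOn hU (contDiffOn_fderiv_aux hU hL1) hq
  have hs := hasFDerivAt_fderiv_of_contDiffOn hU (G.contDiffOn_spray he) hq
  have a := (h2.clm_apply ((hasFDerivAt_const (0 : E) q).prodMk hs)).clm_apply
    (hasFDerivAt_const ((0, Z) : E × E) q)
  have b := ((h2.clm_apply ((hasFDerivAt_snd (𝕜 := ℝ) (p := q)).prodMk
    (hasFDerivAt_const (0 : E) q))).clm_apply (hasFDerivAt_const ((0, Z) : E × E) q)).sub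
    (h1.clm_apply (hasFDerivAt_const ((Z, 0) : E × E) q))
  have d := congrArg (fun f : E × E →L[ℝ] ℝ => f (0, q.2)) (a.unique (b.congr_of_eventuallyEq
    (by filter_upwards [hU.mem_nhds hq] with q hq using G.fderiv_fderiv_lCoord_spray he hq Z)))
  simp at d
  rw [G.euler_aux he hq, fderiv_three_symm_left hU hL hq (0, q.2),
    fderiv_three_symm_right hU hL hq] at d
  have e0 := G.fderiv_fderiv_lCoord_spray he hq Z
  have e1 := euler_fderiv_fderiv hU hL hE hq (q.2, 0) (0, Z)
  have e2 := euler_fderiv hU hL hE hq (Z, 0)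
  rw [fderiv_fderiv_symm_of_contDiffOn hU hL hq] at e2
  have e3 : ((0, fderiv ℝ (G.spray e) q (0, q.2) - (2 : ℝ) • G.spray e q) : E × E) =
    (0, fderiv ℝ (G.spray e) q (0, q.2)) - (2 : ℝ) • (0, G.spray e q) := by simp
  rw [e3, map_sub, map_smul]
  simp only [Prod.mk_zero_zero, map_zero, sub_apply, smul_apply, smul_eq_mul] at e1 e2 ⊢
  linarith

end

end


/-! ### Curves and vector fields along them in charts. -/

section

variable {E : Type*} [NormedAddCommGroup E] [NormedSpace ℝ E]
  {M : Type*} [TopologicalSpace M] [ChartedSpace E M]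

theorem coordField_add (e : OpenPartialHomeomorph M E) (γ : ℝ → M)
    (X Y : ∀ t, TangentSpace 𝓘(ℝ, E) (γ t)) (t : ℝ) :
    coordField e γ (fun t => X t + Y t) t = coordField e γ X t + coordField e γ Y t :=
  map_add (mfderiv 𝓘(ℝ, E) 𝓘(ℝ, E) e (γ t)) (X t) (Y t)

theorem coordField_smul (e : OpenPartialHomeomorph M E) (γ : ℝ → M) (f : ℝ → ℝ)
    (X : ∀ t, TangentSpace 𝓘(ℝ, E) (γ t)) (t : ℝ) :
    coordField e γ (fun t => f t • X t) t = f t • coordField e γ X t :=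
  map_smul (mfderiv 𝓘(ℝ, E) 𝓘(ℝ, E) e (γ t)) (f t) (X t)

variable {e : OpenPartialHomeomorph M E} {S : Set ℝ} {γ : ℝ → M} {t : ℝ}

theorem coordField_eq_smul {X Y : ∀ t, TangentSpace 𝓘(ℝ, E) (γ t)} {r : ℝ}
    (h : X t = r • Y t) : coordField e γ X t = r • coordField e γ Y t := by
  rw [coordField, h]
  exact map_smul (mfderiv 𝓘(ℝ, E) 𝓘(ℝ, E) e (γ t)) r (Y t)

theorem eventually_mem_source (hγ : ContMDiffOn 𝓘(ℝ, ℝ) 𝓘(ℝ, E) ∞ γ S) (ht : t ∈ S)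
    (hs : γ t ∈ e.source) : ∀ᶠ τ in nhdsWithin t S, τ ∈ S ∧ γ τ ∈ e.source :=
  (eventually_mem_nhdsWithin).and
    ((hγ t ht).continuousWithinAt.eventually_mem (e.open_source.mem_nhds hs))

theorem contDiffWithinAt_chart_comp (he : e ∈ IsManifold.maximalAtlas 𝓘(ℝ, E) ∞ M)
    (hγ : ContMDiffOn 𝓘(ℝ, ℝ) 𝓘(ℝ, E) ∞ γ S) (ht : t ∈ S) (hs : γ t ∈ e.source) :
    ContDiffWithinAt ℝ ∞ (e ∘ γ) S t :=
  contMDiffWithinAt_iff_contDiffWithinAt.1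
    (((contMDiffOn_of_mem_maximalAtlas he).contMDiffAt
      (e.open_source.mem_nhds hs)).comp_contMDiffWithinAt t (hγ t ht))

variable [IsManifold 𝓘(ℝ, E) ∞ M] (G : PseudoFinslerMetric E M)

/-- The equality is stated in `E` because its sides lie in the tangent spaces at `e.symm (e p)` and
at `p`, points which are equal but not definitionally so. -/
theorem ofCoord_mfderiv (he : e ∈ IsManifold.maximalAtlas 𝓘(ℝ, E) ∞ M) {p : M} (hp : p ∈ e.source)
    (v : TangentSpace 𝓘(ℝ, E) p) :
    (ofCoord e (e p) (mfderiv 𝓘(ℝ, E) 𝓘(ℝ, E) e p v) : E) = v :=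
  congrArg (fun A : E →L[ℝ] E => A v)
    ((mdifferentiable_of_mem_maximalAtlas_aux e he).symm_comp_deriv hp)

theorem mk_ofCoord_mfderiv (he : e ∈ IsManifold.maximalAtlas 𝓘(ℝ, E) ∞ M) {p : M}
    (hp : p ∈ e.source) (v : TangentSpace 𝓘(ℝ, E) p) :
    (⟨e.symm (e p), ofCoord e (e p) (mfderiv 𝓘(ℝ, E) 𝓘(ℝ, E) e p v)⟩ :
      TangentBundle 𝓘(ℝ, E) M) = ⟨p, v⟩ := by
  have h : ∀ (p' : M) (w v : E), p' = p → w = v →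
      (⟨p', w⟩ : TangentBundle 𝓘(ℝ, E) M) = ⟨p, v⟩ := by
    rintro p' w v rfl rfl; rfl
  exact h _ _ _ (e.left_inv hp) (ofCoord_mfderiv he hp v)

theorem fundamentalTensor_eq_gCoord (he : e ∈ IsManifold.maximalAtlas 𝓘(ℝ, E) ∞ M) {p : M}
    (hp : p ∈ e.source) (v u w : TangentSpace 𝓘(ℝ, E) p) :
    fundamentalTensor G.L v u w = G.gCoord e (e p) (mfderiv 𝓘(ℝ, E) 𝓘(ℝ, E) e p v)
      (mfderiv 𝓘(ℝ, E) 𝓘(ℝ, E) e p u) (mfderiv 𝓘(ℝ, E) 𝓘(ℝ, E) e p w) := by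
  -- Generalizing the base point together with the vectors avoids rewriting inside dependent types.
  have h : ∀ (p' : M) (v' u' w' v u w : E), p' = p → v' = v → u' = u → w' = w →
      fundamentalTensor (p := p) G.L v u w = fundamentalTensor (p := p') G.L v' u' w' := by
    rintro p' v' u' w' v u w rfl rfl rfl rfl; rfl
  exact h _ _ _ _ _ _ _ (e.left_inv hp) (ofCoord_mfderiv he hp v) (ofCoord_mfderiv he hp u)
    (ofCoord_mfderiv he hp w)

theorem contMDiffOn_mfderiv_chart (he : e ∈ IsManifold.maximalAtlas 𝓘(ℝ, E) ∞ M) :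
    ContMDiffOn 𝓘(ℝ, E).tangent 𝓘(ℝ, E) ∞
      (fun z : TangentBundle 𝓘(ℝ, E) M => (mfderiv 𝓘(ℝ, E) 𝓘(ℝ, E) e z.1 z.2 : E))
      (Bundle.TotalSpace.proj ⁻¹' e.source) := by
  have h1 := (contMDiffOn_of_mem_maximalAtlas he).contMDiffOn_tangentMapWithin
    (m := ∞) (by simp) e.open_source.uniqueMDiffOn
  have h2 := contMDiff_snd_tangentBundle_modelSpace (H := E) (I := 𝓘(ℝ, E)) (n := ∞)
  refine (h2.comp_contMDiffOn h1).congr fun z hz => ?_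
  have : mfderivWithin 𝓘(ℝ, E) 𝓘(ℝ, E) e e.source z.1 = mfderiv 𝓘(ℝ, E) 𝓘(ℝ, E) e z.1 :=
    mfderivWithin_of_mem_nhds (e.open_source.mem_nhds hz)
  simp only [Function.comp, tangentMapWithin, this]
  rfl

variable {X : ∀ t, TangentSpace 𝓘(ℝ, E) (γ t)}

theorem contDiffWithinAt_coordField (he : e ∈ IsManifold.maximalAtlas 𝓘(ℝ, E) ∞ M)
    (hX : ContMDiffOn 𝓘(ℝ, ℝ) 𝓘(ℝ, E).tangent ∞
      (fun t => (⟨γ t, X t⟩ : TangentBundle 𝓘(ℝ, E) M)) S) (ht : t ∈ S) (hs : γ t ∈ e.source) :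
    ContDiffWithinAt ℝ ∞ (coordField e γ X) S t :=
  contMDiffWithinAt_iff_contDiffWithinAt.1
    (((contMDiffOn_mfderiv_chart he).contMDiffAt
      ((e.open_source.preimage (FiberBundle.continuous_proj E _)).mem_nhds
        hs)).comp_contMDiffWithinAt t (hX t ht))

/-- Converse of `contDiffWithinAt_coordField`: the field is recovered by composing its coordinates
with the smooth map `ofCoord`. -/
theorem contMDiffOn_of_coordField (hγ : ContMDiffOn 𝓘(ℝ, ℝ) 𝓘(ℝ, E) ∞ γ S)
    (h : ∀ e ∈ IsManifold.maximalAtlas 𝓘(ℝ, E) ∞ M, ∀ t ∈ S, γ t ∈ e.source →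
      ContDiffWithinAt ℝ ∞ (coordField e γ X) S t) :
    ContMDiffOn 𝓘(ℝ, ℝ) 𝓘(ℝ, E).tangent ∞
      (fun t => (⟨γ t, X t⟩ : TangentBundle 𝓘(ℝ, E) M)) S := by
  intro t ht
  have he := IsManifold.chart_mem_maximalAtlas (I := 𝓘(ℝ, E)) (n := ∞) (γ t)
  have hs := mem_chart_source E (γ t)
  set e := chartAt E (γ t)
  have h1 : ContMDiffWithinAt 𝓘(ℝ, ℝ) 𝓘(ℝ, E × E) ∞
      (fun τ => (e (γ τ), coordField e γ X τ)) S t :=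
    contMDiffWithinAt_iff_contDiffWithinAt.2
      ((contDiffWithinAt_chart_comp he hγ ht hs).prodMk (h e he t ht hs))
  have h2 := ((contMDiffOn_ofCoord e he).contMDiffAt (x := (e (γ t), coordField e γ X t))
    ((e.open_target.preimage continuous_fst).mem_nhds (e.map_source hs))).comp_contMDiffWithinAt t
      h1
  refine h2.congr_of_eventuallyEq ?_ (mk_ofCoord_mfderiv he hs (X t)).symm
  filter_upwards [eventually_mem_source hγ ht hs] with τ hτ
  exact (mk_ofCoord_mfderiv he hτ.2 (X τ)).symm

theorem coordField_velocity (he : e ∈ IsManifold.maximalAtlas 𝓘(ℝ, E) ∞ M)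
    (hS : UniqueDiffOn ℝ S) (hγ : ContMDiffOn 𝓘(ℝ, ℝ) 𝓘(ℝ, E) ∞ γ S) (ht : t ∈ S)
    (hs : γ t ∈ e.source) :
    coordField e γ (velocity S γ) t = derivWithin (e ∘ γ) S t := by
  have h := mfderiv_comp_mfderivWithin (I := 𝓘(ℝ, ℝ)) (I' := 𝓘(ℝ, E)) (I'' := 𝓘(ℝ, E)) t (g := e)
    ((mdifferentiable_of_mem_maximalAtlas_aux e he).mdifferentiableAt hs)
    ((hγ t ht).mdifferentiableWithinAt (by simp)) (hS t ht).uniqueMDiffWithinAt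
  rw [mfderivWithin_eq_fderivWithin] at h
  exact (congrArg (fun A : ℝ →L[ℝ] E => A 1) h).symm

theorem hasDerivWithinAt_chart_comp (he : e ∈ IsManifold.maximalAtlas 𝓘(ℝ, E) ∞ M)
    (hS : UniqueDiffOn ℝ S) (hγ : ContMDiffOn 𝓘(ℝ, ℝ) 𝓘(ℝ, E) ∞ γ S) (ht : t ∈ S)
    (hs : γ t ∈ e.source) :
    HasDerivWithinAt (e ∘ γ) (coordField e γ (velocity S γ) t) S t := by
  rw [coordField_velocity he hS hγ ht hs]
  exact ((contDiffWithinAt_chart_comp he hγ ht hs).differentiableWithinAt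
    (by simp)).hasDerivWithinAt

theorem _root_.ContDiffWithinAt.derivWithin_infty {f : ℝ → E} (hS : UniqueDiffOn ℝ S)
    (hf : ContDiffWithinAt ℝ ∞ f S t) (ht : t ∈ S) :
    ContDiffWithinAt ℝ ∞ (derivWithin f S) S t :=
  (hf.fderivWithin_right hS (m := ∞) (by simp) ht).clm_apply contDiffWithinAt_const

theorem contMDiffOn_velocity (hS : UniqueDiffOn ℝ S)
    (hγ : ContMDiffOn 𝓘(ℝ, ℝ) 𝓘(ℝ, E) ∞ γ S) :
    ContMDiffOn 𝓘(ℝ, ℝ) 𝓘(ℝ, E).tangent ∞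
      (fun t => (⟨γ t, velocity S γ t⟩ : TangentBundle 𝓘(ℝ, E) M)) S := by
  refine contMDiffOn_of_coordField hγ fun e he t ht hs => ?_
  refine ((contDiffWithinAt_chart_comp he hγ ht hs).derivWithin_infty hS ht).congr_of_eventuallyEq
    ?_ (coordField_velocity he hS hγ ht hs)
  filter_upwards [eventually_mem_source hγ ht hs] with τ hτ
  exact coordField_velocity he hS hγ hτ.1 hτ.2

end


/-! ### The geodesic and Jacobi equations in a chart. -/

section

variable {E : Type*} [NormedAddCommGroup E] [NormedSpace ℝ E]
  {M : Type*} [TopologicalSpace M] [ChartedSpace E M] [IsManifold 𝓘(ℝ, E) ∞ M]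
  {G : PseudoFinslerMetric E M} {e : OpenPartialHomeomorph M E} {γ : ℝ → M} {a b t : ℝ}

theorem IsGeodesic.mem_domainCoord (hγ : G.IsGeodesic a b γ)
    (he : e ∈ IsManifold.maximalAtlas 𝓘(ℝ, E) ∞ M) (ht : t ∈ Icc a b) (hs : γ t ∈ e.source) :
    (e (γ t), coordField e γ (velocity (Icc a b) γ) t) ∈ G.domainCoord e := by
  refine ⟨e.map_source hs, ?_⟩
  have := mk_ofCoord_mfderiv he hs (velocity (Icc a b) γ t)
  exact this ▸ hγ.admissible t ht

theorem IsGeodesic.contDiffWithinAt_coordField_velocity (hγ : G.IsGeodesic a b γ) (hab : a < b)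
    (he : e ∈ IsManifold.maximalAtlas 𝓘(ℝ, E) ∞ M) (ht : t ∈ Icc a b) (hs : γ t ∈ e.source) :
    ContDiffWithinAt ℝ ∞ (coordField e γ (velocity (Icc a b) γ)) (Icc a b) t :=
  contDiffWithinAt_coordField he (contMDiffOn_velocity (uniqueDiffOn_Icc hab) hγ.smooth) ht hs

theorem IsGeodesic.derivWithin_chart_comp (hγ : G.IsGeodesic a b γ) (hab : a < b)
    (he : e ∈ IsManifold.maximalAtlas 𝓘(ℝ, E) ∞ M) (ht : t ∈ Icc a b) (hs : γ t ∈ e.source) :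
    derivWithin (e ∘ γ) (Icc a b) t = coordField e γ (velocity (Icc a b) γ) t :=
  (coordField_velocity he (uniqueDiffOn_Icc hab) hγ.smooth ht hs).symm

/-- The geodesic equation in coordinates. -/
theorem IsGeodesic.hasDerivWithinAt_velocity (hγ : G.IsGeodesic a b γ) (hab : a < b)
    (he : e ∈ IsManifold.maximalAtlas 𝓘(ℝ, E) ∞ M) (ht : t ∈ Icc a b) (hs : γ t ∈ e.source) :
    HasDerivWithinAt (coordField e γ (velocity (Icc a b) γ))
      (-G.spray e (e (γ t), coordField e γ (velocity (Icc a b) γ) t)) (Icc a b) t := by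
  have h := hγ.parallel e he t ht hs
  rw [covDerivCoord, hγ.derivWithin_chart_comp hab he ht hs] at h
  have h2 := ((hγ.contDiffWithinAt_coordField_velocity hab he ht hs).differentiableWithinAt
    (by simp)).hasDerivWithinAt
  rwa [eq_neg_of_add_eq_zero_left h] at h2

variable [FiniteDimensional ℝ E]

/-- Product rule for S(q) = Γ(q)(y, y); the two undifferentiated-Γ terms are kept apart because they
arise separately in the Jacobi equation. -/
theorem fderiv_spray_apply (he : e ∈ IsManifold.maximalAtlas 𝓘(ℝ, E) ∞ M) {q : E × E}
    (hq : q ∈ G.domainCoord e) (ξ : E × E) : fderiv ℝ (G.spray e) q ξ =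
      fderiv ℝ (fun q : E × E => G.christoffel e q.1 q.2) q ξ q.2 q.2 +
        G.christoffel e q.1 q.2 ξ.2 q.2 + G.christoffel e q.1 q.2 q.2 ξ.2 := by
  have h := hasFDerivAt_fderiv_of_contDiffOn (G.isOpen_domainCoord e he)
    (G.contDiffOn_christoffel he) hq
  have h2 := (h.clm_apply (hasFDerivAt_snd (𝕜 := ℝ) (p := q))).clm_apply
    (hasFDerivAt_snd (𝕜 := ℝ) (p := q))
  have h3 : fderiv ℝ (G.spray e) q = _ := h2.fderiv
  rw [h3]
  simp
  abel

/-- The Jacobi equation is the linearization of the geodesic equation. -/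
theorem IsGeodesic.jacobi_equation_iff (hγ : G.IsGeodesic a b γ) (hab : a < b)
    (he : e ∈ IsManifold.maximalAtlas 𝓘(ℝ, E) ∞ M) (ht : t ∈ Icc a b) (hs : γ t ∈ e.source)
    {J : ∀ t, TangentSpace 𝓘(ℝ, E) (γ t)}
    (hJ : ContMDiffOn 𝓘(ℝ, ℝ) 𝓘(ℝ, E).tangent ∞
      (fun t => (⟨γ t, J t⟩ : TangentBundle 𝓘(ℝ, E) M)) (Icc a b)) :
    G.covDerivCoord e (Icc a b) (e ∘ γ) (coordField e γ (velocity (Icc a b) γ))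
      (G.covDerivCoord e (Icc a b) (e ∘ γ) (coordField e γ (velocity (Icc a b) γ))
        (coordField e γ J)) t =
      G.jacobiOperatorCoord e (Icc a b) γ J (velocity (Icc a b) γ) t ↔
    derivWithin (derivWithin (coordField e γ J) (Icc a b)) (Icc a b) t +
      fderiv ℝ (G.spray e) (e (γ t), coordField e γ (velocity (Icc a b) γ) t)
        (coordField e γ J t, derivWithin (coordField e γ J) (Icc a b) t) = 0 := by
  have hS := uniqueDiffOn_Icc hab
  have hN := eventually_mem_source hγ.smooth ht hs
  have hq := fun τ (h1 : τ ∈ Icc a b) (h2 : γ τ ∈ e.source) => hγ.mem_domainCoord he h1 h2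
  have hdc := fun τ (h1 : τ ∈ Icc a b) (h2 : γ τ ∈ e.source) =>
    hγ.derivWithin_chart_comp hab he h1 h2
  have hgeo := hγ.parallel e he t ht hs
  have hdJ : ∀ τ ∈ Icc a b, γ τ ∈ e.source →
      DifferentiableWithinAt ℝ (coordField e γ J) (Icc a b) τ := fun τ h1 h2 =>
    (contDiffWithinAt_coordField he hJ h1 h2).differentiableWithinAt (by simp)
  have hdJ1 := ((contDiffWithinAt_coordField he hJ ht hs).derivWithin_infty hS
    ht).differentiableWithinAt (by simp)
  have hdV := (hγ.contDiffWithinAt_coordField_velocity hab he ht hs).differentiableWithinAt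
    (by simp)
  have hdC := (contDiffWithinAt_chart_comp he hγ.smooth ht hs).differentiableWithinAt (by simp)
  have hdC' : ∀ τ ∈ Icc a b, γ τ ∈ e.source → DifferentiableWithinAt ℝ (e ∘ γ) (Icc a b) τ :=
    fun τ h1 h2 => (contDiffWithinAt_chart_comp he hγ.smooth h1 h2).differentiableWithinAt (by simp)
  have hΓ := hasFDerivAt_fderiv_of_contDiffOn (G.isOpen_domainCoord e he)
    (G.contDiffOn_christoffel he) (hq t ht hs)
  rw [covDerivCoord] at hgeo
  rw [fderiv_spray_apply he (hq t ht hs)]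
  unfold jacobiOperatorCoord curvatureCoord
  set S := Icc a b with hSdef
  set v := coordField e γ (velocity S γ) with hv
  set Y := coordField e γ J with hY
  set Y₁ := derivWithin Y S with hY1
  set Γ : ℝ → E →L[ℝ] E →L[ℝ] E := fun τ => G.christoffel e (e (γ τ)) (v τ) with hΓdef
  -- `A` is the connection term of J' and also equals D_β γ̇ at s = 0. Its derivative and Γ(A, v)
  -- occur both in J'' and in the curvature, so they cancel without being computed.
  set A : ℝ → E := fun τ => Γ τ (v τ) (Y τ) with hA
  have hdΓ : DifferentiableWithinAt ℝ Γ S t :=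
    DifferentiableAt.comp_differentiableWithinAt (f := fun τ => (e (γ τ), v τ)) t
      hΓ.differentiableAt (hdC.prodMk hdV)
  have hdA : DifferentiableWithinAt ℝ A S t := (hdΓ.clm_apply hdV).clm_apply (hdJ t ht hs)
  have hsymm : ∀ τ ∈ S, γ τ ∈ e.source → ∀ X Z, Γ τ X Z = Γ τ Z X := fun τ h1 h2 X Z =>
    G.christoffel_symm he (hq τ h1 h2) X Z
  have hD1 : ∀ τ ∈ S, γ τ ∈ e.source → G.covDerivCoord e S (e ∘ γ) v Y τ = Y₁ τ + A τ := by
    intro τ h1 h2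
    rw [covDerivCoord, hdc τ h1 h2]
    exact congrArg (Y₁ τ + ·) (hsymm τ h1 h2 _ _)
  have hD2 : G.covDerivCoord e S (e ∘ γ) v (G.covDerivCoord e S (e ∘ γ) v Y) t =
      derivWithin Y₁ S t + derivWithin A S t + Γ t (Y₁ t + A t) (v t) := by
    rw [covDerivCoord, hD1 t ht hs, hdc t ht hs, ← derivWithin_add hdJ1 hdA]
    congr 1
    exact Filter.EventuallyEq.derivWithin_eq
      (by filter_upwards [hN] with τ hτ using hD1 τ hτ.1 hτ.2) (hD1 t ht hs)
  have hT : ∀ τ ∈ S, γ τ ∈ e.source → ∀ s : ℝ,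
      derivWithin (fun τ => e (γ τ) + s • Y τ) S τ = v τ + s • Y₁ τ := by
    intro τ h1 h2 s
    have := ((hdC' τ h1 h2).hasDerivWithinAt.add
      ((hdJ τ h1 h2).hasDerivWithinAt.const_smul s)).derivWithin (hS τ h1)
    rw [hdc τ h1 h2] at this
    exact this
  -- The extension of γ̇ is constant in s, so only the connection term survives.
  have hβ : ∀ τ ∈ S, γ τ ∈ e.source →
      G.covDerivCoord e univ (fun σ => e (γ τ) + σ • Y τ)
        (fun σ => derivWithin (fun τ => e (γ τ) + σ • Y τ) S τ) (fun _ => v τ) 0 = A τ := by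
    intro τ h1 h2
    have h3 : HasDerivAt (fun σ : ℝ => e (γ τ) + σ • Y τ) (Y τ) 0 := by
      simpa using ((hasDerivAt_id (0 : ℝ)).smul_const (Y τ)).const_add (e (γ τ))
    rw [covDerivCoord, derivWithin_univ, derivWithin_univ, h3.deriv, hT τ h1 h2]
    simp [A, Γ]
  have hDγ : ∀ σ : ℝ, G.covDerivCoord e S (fun τ => e (γ τ) + σ • Y τ)
        (fun τ => derivWithin (fun τ => e (γ τ) + σ • Y τ) S τ) v t =
      derivWithin v S t + G.christoffel e (e (γ t) + σ • Y t) (v t + σ • Y₁ t) (v t)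
        (v t + σ • Y₁ t) := by
    intro σ
    rw [covDerivCoord, hT t ht hs]
  have hR1 : G.covDerivCoord e S (fun τ => e (γ τ) + (0 : ℝ) • Y τ)
      (fun τ => derivWithin (fun τ => e (γ τ) + (0 : ℝ) • Y τ) S τ)
      (fun τ => G.covDerivCoord e univ (fun σ => e (γ τ) + σ • Y τ)
        (fun σ => derivWithin (fun τ => e (γ τ) + σ • Y τ) S τ) (fun _ => v τ) 0) t =
      derivWithin A S t + Γ t (A t) (v t) := by
    rw [covDerivCoord, hβ t ht hs, hT t ht hs, Filter.EventuallyEq.derivWithin_eq (f := A)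
      (by filter_upwards [hN] with τ hτ using hβ τ hτ.1 hτ.2) (hβ t ht hs)]
    simp [Γ]
  have hR2 : G.covDerivCoord e univ (fun σ => e (γ t) + σ • Y t)
      (fun σ => derivWithin (fun τ => e (γ τ) + σ • Y τ) S t)
      (fun σ => G.covDerivCoord e S (fun τ => e (γ τ) + σ • Y τ)
        (fun τ => derivWithin (fun τ => e (γ τ) + σ • Y τ) S τ) v t) 0 =
      fderiv ℝ (fun q : E × E => G.christoffel e q.1 q.2) (e (γ t), v t) (Y t, Y₁ t) (v t) (v t) +
        Γ t (v t) (Y₁ t) := by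
    have h3 : HasDerivAt (fun σ : ℝ => e (γ t) + σ • Y t) (Y t) 0 := by
      simpa using ((hasDerivAt_id (0 : ℝ)).smul_const (Y t)).const_add (e (γ t))
    have h4 : HasDerivAt (fun σ : ℝ => v t + σ • Y₁ t) (Y₁ t) 0 := by
      simpa using ((hasDerivAt_id (0 : ℝ)).smul_const (Y₁ t)).const_add (v t)
    have h5 := hasDerivAt_line_aux hΓ.differentiableAt (Y t, Y₁ t)
    have h6 := ((h5.clm_apply (hasDerivAt_const (0 : ℝ) (v t))).clm_apply h4).const_add
      (derivWithin v S t)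
    rw [covDerivCoord]
    simp only [hDγ]
    rw [derivWithin_univ, derivWithin_univ, h3.deriv, hT t ht hs]
    rw [hdc t ht hs] at hgeo
    -- At σ = 0 the inner covariant derivative is D_γ γ̇ = 0, so the outer one has no connection
    -- term and is an ordinary derivative in σ.
    have h7 : derivWithin v S t + G.christoffel e (e (γ t) + (0 : ℝ) • Y t)
        (v t + (0 : ℝ) • Y₁ t) (v t) (v t + (0 : ℝ) • Y₁ t) = 0 := by simpa using hgeo
    rw [h7]
    simp only [map_zero, zero_apply, add_zero]
    refine h6.deriv.trans ?_
    simp [Γ]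
  rw [hD2]
  refine (Eq.congr rfl (congrArg₂ (· - ·) hR1 hR2)).trans ?_
  rw [← sub_eq_zero]
  refine Eq.congr ?_ rfl
  simp only [map_add, add_apply]
  change _ = derivWithin Y₁ S t + (_ + Γ t (Y₁ t) (v t) + Γ t (v t) (Y₁ t))
  abel

end

end PseudoFinslerMetric

/-! ### The function g_γ̇(γ̇, J) along geodesics and Jacobi fields. -/

theorem eq_affine_of_hasDerivWithinAt {f f' : ℝ → ℝ} {a b : ℝ} (hab : a < b)
    (hf : ∀ t ∈ Icc a b, HasDerivWithinAt f (f' t) (Icc a b) t)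
    (hf' : ∀ t ∈ Icc a b, HasDerivWithinAt f' 0 (Icc a b) t) :
    ∀ t ∈ Icc a b, f' t = f' a ∧ f t = f a + f' a * (t - a) := by
  have hS := uniqueDiffOn_Icc hab
  have h1 : ∀ t ∈ Icc a b, f' t = f' a := constant_of_derivWithin_zero
    (fun t ht => (hf' t ht).differentiableWithinAt)
    fun t ht => (hf' t (Ico_subset_Icc_self ht)).derivWithin (hS t (Ico_subset_Icc_self ht))
  have h2 : ∀ t ∈ Icc a b, HasDerivWithinAt (fun t => f t - f' a * (t - a)) 0 (Icc a b) t := by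
    intro t ht
    have := (hf t ht).sub (((hasDerivWithinAt_id t (Icc a b)).sub_const a).const_mul (f' a))
    rw [h1 t ht, mul_one, sub_self] at this
    exact this
  refine fun t ht => ⟨h1 t ht, ?_⟩
  have := constant_of_derivWithin_zero (fun t ht => (h2 t ht).differentiableWithinAt)
    (fun t ht => (h2 t (Ico_subset_Icc_self ht)).derivWithin (hS t (Ico_subset_Icc_self ht))) t ht
  linarith

theorem hasDerivWithinAt_fderiv_apply {V : Type*} [NormedAddCommGroup V] [NormedSpace ℝ V]
    {f : V → ℝ} {U : Set V} (hU : IsOpen U) (hf : ContDiffOn ℝ ∞ f U) {z w : ℝ → V} {z' w' : V}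
    {S : Set ℝ} {t : ℝ} (ht : z t ∈ U) (hz : HasDerivWithinAt z z' S t)
    (hw : HasDerivWithinAt w w' S t) :
    HasDerivWithinAt (fun t => fderiv ℝ f (z t) (w t))
      (fderiv ℝ (fderiv ℝ f) (z t) z' (w t) + fderiv ℝ f (z t) w') S t :=
  ((hasFDerivAt_fderiv_of_contDiffOn hU (contDiffOn_fderiv_aux hU hf)
    ht).comp_hasDerivWithinAt t hz).clm_apply hw

namespace PseudoFinslerMetric

section

variable {E : Type*} [NormedAddCommGroup E] [NormedSpace ℝ E]
  {M : Type*} [TopologicalSpace M] [ChartedSpace E M] [IsManifold 𝓘(ℝ, E) ∞ M]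
  {G : PseudoFinslerMetric E M} {e : OpenPartialHomeomorph M E} {γ : ℝ → M} {a b t : ℝ}
  {J : ∀ t, TangentSpace 𝓘(ℝ, E) (γ t)}

/-- By Euler's relation, pairing with γ̇ needs only the first derivative of `L`. -/
theorem IsGeodesic.fundamentalTensor_velocity (hγ : G.IsGeodesic a b γ)
    (he : e ∈ IsManifold.maximalAtlas 𝓘(ℝ, E) ∞ M) (ht : t ∈ Icc a b) (hs : γ t ∈ e.source)
    (w : TangentSpace 𝓘(ℝ, E) (γ t)) :
    fundamentalTensor G.L (velocity (Icc a b) γ t) (velocity (Icc a b) γ t) w =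
      (1 / 2) * fderiv ℝ (G.lCoord e) (e (γ t), coordField e γ (velocity (Icc a b) γ) t)
        (0, mfderiv 𝓘(ℝ, E) 𝓘(ℝ, E) e (γ t) w) := by
  have hq := hγ.mem_domainCoord he ht hs
  have hU := G.isOpen_domainCoord e he
  have hL := G.contDiffOn_lCoord e he
  rw [G.fundamentalTensor_eq_gCoord he hs]
  refine (G.gCoord_eq he hq _ _).trans ?_
  rw [fderiv_fderiv_symm_of_contDiffOn hU hL hq]
  refine congrArg _ ((euler_fderiv hU hL (fun q hq => G.fderiv_lCoord_fiber he hq) hq _).trans ?_)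
  ring

theorem IsGeodesic.fundamentalTensor_velocity_velocity (hγ : G.IsGeodesic a b γ)
    (ht : t ∈ Icc a b) :
    fundamentalTensor G.L (velocity (Icc a b) γ t) (velocity (Icc a b) γ t)
      (velocity (Icc a b) γ t) = G.L ⟨γ t, velocity (Icc a b) γ t⟩ := by
  have he := IsManifold.chart_mem_maximalAtlas (I := 𝓘(ℝ, E)) (n := ∞) (γ t)
  have hs := mem_chart_source E (γ t)
  have h := G.fderiv_lCoord_fiber he (hγ.mem_domainCoord he ht hs)
  rw [hγ.fundamentalTensor_velocity he ht hs]
  refine (congrArg _ h).trans ?_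
  rw [lCoord, coordField, mk_ofCoord_mfderiv he hs]
  ring

theorem IsGeodesic.hasDerivWithinAt_tangentLift (hγ : G.IsGeodesic a b γ) (hab : a < b)
    (he : e ∈ IsManifold.maximalAtlas 𝓘(ℝ, E) ∞ M) (ht : t ∈ Icc a b) (hs : γ t ∈ e.source) :
    HasDerivWithinAt (fun τ => (e (γ τ), coordField e γ (velocity (Icc a b) γ) τ))
      (coordField e γ (velocity (Icc a b) γ) t,
        -G.spray e (e (γ t), coordField e γ (velocity (Icc a b) γ) t)) (Icc a b) t :=
  (hasDerivWithinAt_chart_comp he (uniqueDiffOn_Icc hab) hγ.smooth ht hs).prodMk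
    (hγ.hasDerivWithinAt_velocity hab he ht hs)

variable [FiniteDimensional ℝ E]

/-- Linearization of the conservation of `L` by the geodesic spray. -/
theorem fderiv_fderiv_lCoord_geodesic (he : e ∈ IsManifold.maximalAtlas 𝓘(ℝ, E) ∞ M) {q : E × E}
    (hq : q ∈ G.domainCoord e) (ξ : E × E) :
    fderiv ℝ (fderiv ℝ (G.lCoord e)) q (q.2, -G.spray e q) ξ +
      fderiv ℝ (G.lCoord e) q (ξ.2, -fderiv ℝ (G.spray e) q ξ) = 0 := by
  have hU := G.isOpen_domainCoord e he
  have hL := G.contDiffOn_lCoord e he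
  have hL1 := hasFDerivAt_fderiv_of_contDiffOn hU (contDiffOn_fderiv_aux hU hL) hq
  have hF := hasFDerivAt_fderiv_of_contDiffOn hU (G.contDiffOn_spray he) hq
  have h4 := hL1.clm_apply ((hasFDerivAt_snd (𝕜 := ℝ) (p := q)).prodMk hF.neg)
  have h5 := (hasFDerivAt_const (𝕜 := ℝ) (0 : ℝ) q).congr_of_eventuallyEq
    (f₁ := fun q : E × E => fderiv ℝ (G.lCoord e) q (q.2, -G.spray e q))
    (by filter_upwards [hU.mem_nhds hq] with q hq using G.fderiv_lCoord_spray he hq)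
  have h6 := congrArg (fun f : E × E →L[ℝ] ℝ => f ξ) (h4.unique h5)
  rw [fderiv_fderiv_symm_of_contDiffOn hU hL hq, add_comm]
  simpa using h6

/-- `L` is constant along geodesics. -/
theorem IsGeodesic.L_velocity_eq (hγ : G.IsGeodesic a b γ) (hab : a < b) (ht : t ∈ Icc a b) :
    G.L ⟨γ t, velocity (Icc a b) γ t⟩ = G.L ⟨γ a, velocity (Icc a b) γ a⟩ := by
  have h : ∀ t ∈ Icc a b, HasDerivWithinAt (fun t => G.L ⟨γ t, velocity (Icc a b) γ t⟩) 0
      (Icc a b) t := by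
    intro t ht
    have he := IsManifold.chart_mem_maximalAtlas (I := 𝓘(ℝ, E)) (n := ∞) (γ t)
    have hs := mem_chart_source E (γ t)
    set e := chartAt E (γ t)
    have hq := hγ.mem_domainCoord he ht hs
    have h1 := (hasFDerivAt_fderiv_of_contDiffOn (G.isOpen_domainCoord e he)
      (G.contDiffOn_lCoord e he) hq).comp_hasDerivWithinAt t
        (hγ.hasDerivWithinAt_tangentLift hab he ht hs)
    rw [G.fderiv_lCoord_spray he hq] at h1
    have h2 : ∀ τ, γ τ ∈ e.source → G.L ⟨γ τ, velocity (Icc a b) γ τ⟩ =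
        G.lCoord e (e (γ τ), coordField e γ (velocity (Icc a b) γ) τ) := by
      intro τ hτ
      rw [lCoord, coordField, mk_ofCoord_mfderiv he hτ]
    refine h1.congr_of_eventuallyEq ?_ (h2 t hs)
    filter_upwards [eventually_mem_source hγ.smooth ht hs] with τ hτ using h2 τ hτ.2
  exact constant_of_derivWithin_zero (fun t ht => (h t ht).differentiableWithinAt)
    (fun t ht => (h t (Ico_subset_Icc_self ht)).derivWithin
      (uniqueDiffOn_Icc hab t (Ico_subset_Icc_self ht))) t ht

/-- First variation: the derivative of `g_γ̇(γ̇, J)` in coordinates. -/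
theorem IsGeodesic.hasDerivWithinAt_fundamentalTensor (hγ : G.IsGeodesic a b γ) (hab : a < b)
    (hJ : ContMDiffOn 𝓘(ℝ, ℝ) 𝓘(ℝ, E).tangent ∞
      (fun t => (⟨γ t, J t⟩ : TangentBundle 𝓘(ℝ, E) M)) (Icc a b))
    (he : e ∈ IsManifold.maximalAtlas 𝓘(ℝ, E) ∞ M) (ht : t ∈ Icc a b) (hs : γ t ∈ e.source) :
    HasDerivWithinAt (fun t => fundamentalTensor G.L (velocity (Icc a b) γ t)
        (velocity (Icc a b) γ t) (J t))
      ((1 / 2) * fderiv ℝ (G.lCoord e) (e (γ t), coordField e γ (velocity (Icc a b) γ) t)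
        (coordField e γ J t, derivWithin (coordField e γ J) (Icc a b) t)) (Icc a b) t := by
  have hq := hγ.mem_domainCoord he ht hs
  have hU := G.isOpen_domainCoord e he
  have hL := G.contDiffOn_lCoord e he
  have hY := ((contDiffWithinAt_coordField he hJ ht hs).differentiableWithinAt
    (by simp)).hasDerivWithinAt
  have h1 := (hasFDerivAt_fderiv_of_contDiffOn hU
    (contDiffOn_fderiv_aux hU hL) hq).comp_hasDerivWithinAt t
      (hγ.hasDerivWithinAt_tangentLift hab he ht hs)
  have h2 := (h1.clm_apply ((hasDerivWithinAt_const t (Icc a b) (0 : E)).prodMk hY)).const_mul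
    (1 / 2 : ℝ)
  have h3 := h2.congr_of_eventuallyEq (f₁ := fun t => fundamentalTensor G.L
      (velocity (Icc a b) γ t) (velocity (Icc a b) γ t) (J t))
    (by filter_upwards [eventually_mem_source hγ.smooth ht hs] with τ hτ
        exact hγ.fundamentalTensor_velocity he hτ.1 hτ.2 (J τ))
    (hγ.fundamentalTensor_velocity he ht hs (J t))
  refine h3.congr_deriv ?_
  set q : E × E := (e (γ t), coordField e γ (velocity (Icc a b) γ) t) with hqdef
  -- The Euler-Lagrange formula turns the Hessian term D²L((y, -S), (0, Y)) into dL(Y, 0).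
  have h4 := G.fderiv_fderiv_lCoord_spray he hq (coordField e γ J t)
  have h5 : ((q.2, -G.spray e q) : E × E) = (q.2, 0) - (0, G.spray e q) := by simp
  have h6 : ((coordField e γ J t, derivWithin (coordField e γ J) (Icc a b) t) : E × E) =
    (coordField e γ J t, 0) + (0, derivWithin (coordField e γ J) (Icc a b) t) := by simp
  change 1 / 2 * (fderiv ℝ (fderiv ℝ (G.lCoord e)) q (q.2, -G.spray e q)
    (0, coordField e γ J t) +
    fderiv ℝ (G.lCoord e) q (0, derivWithin (coordField e γ J) (Icc a b) t)) = _
  rw [h5, h6, map_sub, map_add, sub_apply, h4]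
  ring

/-- The coordinates of J' are Y' + Γ(Y, y), and dL(0, Γ(Y, y)) = dL(Y, 0) by horizontality; so ½
dL(0, ·) of J' is the derivative ½ dL(Y, Y') already found. -/
theorem IsGeodesic.hasDerivWithinAt_fundamentalTensor_covDeriv (hγ : G.IsGeodesic a b γ)
    (hab : a < b)
    (hJ : ContMDiffOn 𝓘(ℝ, ℝ) 𝓘(ℝ, E).tangent ∞
      (fun t => (⟨γ t, J t⟩ : TangentBundle 𝓘(ℝ, E) M)) (Icc a b)) (ht : t ∈ Icc a b) :
    HasDerivWithinAt (fun t => fundamentalTensor G.L (velocity (Icc a b) γ t)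
        (velocity (Icc a b) γ t) (J t))
      (fundamentalTensor G.L (velocity (Icc a b) γ t) (velocity (Icc a b) γ t)
        (G.covDeriv (Icc a b) γ J t)) (Icc a b) t := by
  have he := IsManifold.chart_mem_maximalAtlas (I := 𝓘(ℝ, E)) (n := ∞) (γ t)
  have hs := mem_chart_source E (γ t)
  have hq := hγ.mem_domainCoord he ht hs
  refine (hγ.hasDerivWithinAt_fundamentalTensor hab hJ he ht hs).congr_deriv (Eq.symm ?_)
  rw [hγ.fundamentalTensor_velocity he ht hs]
  have h1 : mfderiv 𝓘(ℝ, E) 𝓘(ℝ, E) (chartAt E (γ t)) (γ t) (G.covDeriv (Icc a b) γ J t) =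
      G.covDerivCoord (chartAt E (γ t)) (Icc a b) (chartAt E (γ t) ∘ γ)
        (coordField (chartAt E (γ t)) γ (velocity (Icc a b) γ))
        (coordField (chartAt E (γ t)) γ J) t := by
    let A := (mdifferentiable_of_mem_maximalAtlas_aux _ he).mfderiv hs
    have hA : (A : TangentSpace 𝓘(ℝ, E) (γ t) →L[ℝ] TangentSpace 𝓘(ℝ, E) (chartAt E (γ t) (γ t))) =
      mfderiv 𝓘(ℝ, E) 𝓘(ℝ, E) (chartAt E (γ t)) (γ t) := rfl
    rw [covDeriv, ← hA, ContinuousLinearMap.inverse_equiv]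
    exact A.apply_symm_apply _
  rw [h1, covDerivCoord, hγ.derivWithin_chart_comp hab he ht hs]
  generalize chartAt E (γ t) = e at *
  have h2 := G.fderiv_lCoord_horizontal he hq (coordField e γ J t)
  have h3 : ∀ X Y Z : E, ((X, Y) : E × E) = (X, 0) + (0, Y) ∧
    ((0, Y + Z) : E × E) = (0, Y) + (0, Z) := fun X Y Z => by simp
  rw [(h3 (coordField e γ J t) _ 0).1, (h3 0 _ _).2, map_add, map_add, ← h2, add_comm]
  rfl

/-- `covDeriv` uses a chart that changes with t. Uniqueness of derivatives yields an expression in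
any fixed chart `e`, which can then be differentiated again. -/
theorem IsGeodesic.fundamentalTensor_covDeriv (hγ : G.IsGeodesic a b γ) (hab : a < b)
    (hJ : ContMDiffOn 𝓘(ℝ, ℝ) 𝓘(ℝ, E).tangent ∞
      (fun t => (⟨γ t, J t⟩ : TangentBundle 𝓘(ℝ, E) M)) (Icc a b))
    (he : e ∈ IsManifold.maximalAtlas 𝓘(ℝ, E) ∞ M) (ht : t ∈ Icc a b) (hs : γ t ∈ e.source) :
    fundamentalTensor G.L (velocity (Icc a b) γ t) (velocity (Icc a b) γ t)
        (G.covDeriv (Icc a b) γ J t) =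
      (1 / 2) * fderiv ℝ (G.lCoord e) (e (γ t), coordField e γ (velocity (Icc a b) γ) t)
        (coordField e γ J t, derivWithin (coordField e γ J) (Icc a b) t) :=
  (uniqueDiffOn_Icc hab t ht).eq_deriv _
    (hγ.hasDerivWithinAt_fundamentalTensor_covDeriv hab hJ ht)
    (hγ.hasDerivWithinAt_fundamentalTensor hab hJ he ht hs)

/-- `g_γ̇(γ̇, J)` has vanishing second derivative for every Jacobi field `J`. -/
theorem IsGeodesic.hasDerivWithinAt_fundamentalTensor_jacobi (hγ : G.IsGeodesic a b γ)
    (hab : a < b) (hJ : G.IsJacobiField a b γ J)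
    (he : e ∈ IsManifold.maximalAtlas 𝓘(ℝ, E) ∞ M) (ht : t ∈ Icc a b) (hs : γ t ∈ e.source) :
    HasDerivWithinAt (fun t => fundamentalTensor G.L (velocity (Icc a b) γ t)
      (velocity (Icc a b) γ t) (G.covDeriv (Icc a b) γ J t)) 0 (Icc a b) t := by
  have hS := uniqueDiffOn_Icc hab
  have hq := hγ.mem_domainCoord he ht hs
  have hU := G.isOpen_domainCoord e he
  have hYc := contDiffWithinAt_coordField he hJ.smooth ht hs
  have hY := (hYc.differentiableWithinAt (by simp)).hasDerivWithinAt
  have hY1 : HasDerivWithinAt (derivWithin (coordField e γ J) (Icc a b)) _ (Icc a b) t :=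
    ((hYc.derivWithin_infty hS ht).differentiableWithinAt (by simp)).hasDerivWithinAt
  have hY2 := hY1.congr_deriv (eq_neg_of_add_eq_zero_left
    ((hγ.jacobi_equation_iff hab he ht hs hJ.smooth).1 (hJ.equation e he t ht hs)))
  have h2 := (hasDerivWithinAt_fderiv_apply hU (G.contDiffOn_lCoord e he) hq
    (hγ.hasDerivWithinAt_tangentLift hab he ht hs) (hY.prodMk hY2)).const_mul (1 / 2 : ℝ)
  -- With Y'' = -dS(Y, Y') the derivative of dL(Y, Y') is precisely the linearized conservation law
  -- in the direction (Y, Y').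
  have h3 := h2.congr_deriv ((congrArg ((1 / 2 : ℝ) * ·) (fderiv_fderiv_lCoord_geodesic he hq
    (coordField e γ J t, derivWithin (coordField e γ J) (Icc a b) t))).trans (mul_zero _))
  refine h3.congr_of_eventuallyEq ?_ (hγ.fundamentalTensor_covDeriv hab hJ.smooth he ht hs)
  filter_upwards [eventually_mem_source hγ.smooth ht hs] with τ hτ
  exact hγ.fundamentalTensor_covDeriv hab hJ.smooth he hτ.1 hτ.2

/-- The slope `p` is the constant value of g_γ̇(γ̇, J'); this is what links the two-zero condition
with the condition at one instant. -/
theorem IsGeodesic.fundamentalTensor_jacobi_eq (hγ : G.IsGeodesic a b γ) (hab : a < b)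
    (hJ : G.IsJacobiField a b γ J) : ∃ p r : ℝ, ∀ t ∈ Icc a b,
      fundamentalTensor G.L (velocity (Icc a b) γ t) (velocity (Icc a b) γ t)
        (G.covDeriv (Icc a b) γ J t) = p ∧
      fundamentalTensor G.L (velocity (Icc a b) γ t) (velocity (Icc a b) γ t) (J t) =
        p * t + r := by
  have h := eq_affine_of_hasDerivWithinAt hab
    (fun t ht => hγ.hasDerivWithinAt_fundamentalTensor_covDeriv hab hJ.smooth ht)
    (fun t ht => hγ.hasDerivWithinAt_fundamentalTensor_jacobi hab hJ
      (IsManifold.chart_mem_maximalAtlas (γ t)) ht (mem_chart_source E (γ t)))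
  exact ⟨_, _, fun t ht => ⟨(h t ht).1, (h t ht).2.trans (by rw [mul_sub, add_sub_left_comm])⟩⟩

end


/-! ### Tangent Jacobi fields and the linear structure. -/

section

variable {E : Type*} [NormedAddCommGroup E] [NormedSpace ℝ E]
  {M : Type*} [TopologicalSpace M] [ChartedSpace E M] [IsManifold 𝓘(ℝ, E) ∞ M]
  {G : PseudoFinslerMetric E M} {e : OpenPartialHomeomorph M E} {γ : ℝ → M} {a b t : ℝ}
  {J : ∀ t, TangentSpace 𝓘(ℝ, E) (γ t)}

theorem IsGeodesic.coordField_velocity_ne_zero (hγ : G.IsGeodesic a b γ)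
    (he : e ∈ IsManifold.maximalAtlas 𝓘(ℝ, E) ∞ M) (ht : t ∈ Icc a b) (hs : γ t ∈ e.source) :
    coordField e γ (velocity (Icc a b) γ) t ≠ 0 := by
  intro h
  have h1 := (hγ.mem_domainCoord he ht hs).2
  rw [h] at h1
  have h2 : ofCoord e (e (γ t)) (0 : E) = 0 :=
    map_zero (mfderiv 𝓘(ℝ, E) 𝓘(ℝ, E) e.symm (e (γ t)))
  simp only [h2] at h1
  exact G.zero_notMem _ h1

/-- The proportionality factor of a smooth field tangent to a geodesic is smooth. -/
theorem IsGeodesic.contDiffWithinAt_of_eq_smul (hγ : G.IsGeodesic a b γ) (hab : a < b)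
    (hJ : ContMDiffOn 𝓘(ℝ, ℝ) 𝓘(ℝ, E).tangent ∞
      (fun t => (⟨γ t, J t⟩ : TangentBundle 𝓘(ℝ, E) M)) (Icc a b)) {f : ℝ → ℝ}
    (hf : ∀ t ∈ Icc a b, J t = f t • velocity (Icc a b) γ t) (ht : t ∈ Icc a b) :
    ContDiffWithinAt ℝ ∞ f (Icc a b) t := by
  have he := IsManifold.chart_mem_maximalAtlas (I := 𝓘(ℝ, E)) (n := ∞) (γ t)
  have hs := mem_chart_source E (γ t)
  generalize chartAt E (γ t) = e at *
  -- As γ̇(t) ≠ 0, some functional ℓ is nonzero on it, hence also on nearby velocities, and there f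
  -- = ℓ(J)/ℓ(γ̇).
  obtain ⟨ℓ, hℓ⟩ := SeparatingDual.exists_ne_zero (R := ℝ)
    (hγ.coordField_velocity_ne_zero he ht hs)
  have hV := hγ.contDiffWithinAt_coordField_velocity hab he ht hs
  have hY := contDiffWithinAt_coordField he hJ ht hs
  have h1 : ContDiffWithinAt ℝ ∞ (fun τ => ℓ (coordField e γ J τ) /
      ℓ (coordField e γ (velocity (Icc a b) γ) τ)) (Icc a b) t :=
    (ℓ.contDiff.contDiffAt.comp_contDiffWithinAt t hY).div
      (ℓ.contDiff.contDiffAt.comp_contDiffWithinAt t hV) hℓ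
  have key : ∀ τ ∈ Icc a b, ℓ (coordField e γ (velocity (Icc a b) γ) τ) ≠ 0 →
      f τ = ℓ (coordField e γ J τ) / ℓ (coordField e γ (velocity (Icc a b) γ) τ) := by
    intro τ h1 h2
    rw [coordField_eq_smul (hf τ h1), map_smul, smul_eq_mul, mul_div_cancel_right₀ _ h2]
  refine h1.congr_of_eventuallyEq ?_ (key t ht hℓ)
  filter_upwards [self_mem_nhdsWithin,
    (ℓ.continuous.continuousAt.comp_continuousWithinAt hV.continuousWithinAt).eventually_ne hℓ]
    with τ h1 h2 using key τ h1 h2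

theorem IsGeodesic.contMDiffOn_of_eq_smul (hγ : G.IsGeodesic a b γ) (hab : a < b) {f : ℝ → ℝ}
    (hfs : ∀ t ∈ Icc a b, ContDiffWithinAt ℝ ∞ f (Icc a b) t)
    (hf : ∀ t ∈ Icc a b, J t = f t • velocity (Icc a b) γ t) :
    ContMDiffOn 𝓘(ℝ, ℝ) 𝓘(ℝ, E).tangent ∞
      (fun t => (⟨γ t, J t⟩ : TangentBundle 𝓘(ℝ, E) M)) (Icc a b) := by
  refine contMDiffOn_of_coordField hγ.smooth fun e he t ht hs => ?_
  refine ((hfs t ht).smul (hγ.contDiffWithinAt_coordField_velocity hab he ht hs)).congr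
    (fun τ hτ => ?_) ?_
  · exact coordField_eq_smul (hf τ hτ)
  · exact coordField_eq_smul (hf t ht)

variable [FiniteDimensional ℝ E]

/-- The Jacobi equation for a field tangent to a geodesic. -/
theorem IsGeodesic.linearized_smul_velocity (hγ : G.IsGeodesic a b γ) (hab : a < b) {f : ℝ → ℝ}
    (hfs : ∀ t ∈ Icc a b, ContDiffWithinAt ℝ ∞ f (Icc a b) t)
    (hf : ∀ t ∈ Icc a b, J t = f t • velocity (Icc a b) γ t)
    (he : e ∈ IsManifold.maximalAtlas 𝓘(ℝ, E) ∞ M) (ht : t ∈ Icc a b) (hs : γ t ∈ e.source) :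
    derivWithin (derivWithin (coordField e γ J) (Icc a b)) (Icc a b) t +
      fderiv ℝ (G.spray e) (e (γ t), coordField e γ (velocity (Icc a b) γ) t)
        (coordField e γ J t, derivWithin (coordField e γ J) (Icc a b) t) =
      derivWithin (derivWithin f (Icc a b)) (Icc a b) t •
        coordField e γ (velocity (Icc a b) γ) t := by
  have hS := uniqueDiffOn_Icc hab
  have hq := hγ.mem_domainCoord he ht hs
  have hF := hasFDerivAt_fderiv_of_contDiffOn (G.isOpen_domainCoord e he)
    (G.contDiffOn_spray he) hq
  have hY : ∀ τ ∈ Icc a b, coordField e γ J τ =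
      f τ • coordField e γ (velocity (Icc a b) γ) τ := fun τ hτ => coordField_eq_smul (hf τ hτ)
  have hdf : ∀ τ ∈ Icc a b, HasDerivWithinAt f (derivWithin f (Icc a b) τ) (Icc a b) τ :=
    fun τ hτ => ((hfs τ hτ).differentiableWithinAt (by simp)).hasDerivWithinAt
  have hdf' : HasDerivWithinAt (derivWithin f (Icc a b)) _ (Icc a b) t :=
    (((hfs t ht).derivWithin_infty hS ht).differentiableWithinAt (by simp)).hasDerivWithinAt
  have hV := fun τ (h1 : τ ∈ Icc a b) (h2 : γ τ ∈ e.source) =>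
    hγ.hasDerivWithinAt_velocity hab he h1 h2
  have hF2 : HasDerivWithinAt
      (fun τ => -G.spray e (e (γ τ), coordField e γ (velocity (Icc a b) γ) τ)) _ (Icc a b) t :=
    (hF.comp_hasDerivWithinAt t (hγ.hasDerivWithinAt_tangentLift hab he ht hs)).neg
  have hY1 : ∀ τ ∈ Icc a b, γ τ ∈ e.source → derivWithin (coordField e γ J) (Icc a b) τ =
      f τ • -G.spray e (e (γ τ), coordField e γ (velocity (Icc a b) γ) τ) +
        derivWithin f (Icc a b) τ • coordField e γ (velocity (Icc a b) γ) τ := by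
    intro τ h1 h2
    exact (((hdf τ h1).smul (hV τ h1 h2)).congr hY (hY τ h1)).derivWithin (hS τ h1)
  have h2 := (((hdf t ht).smul hF2).add (hdf'.smul (hV t ht hs))).congr_of_eventuallyEq
    (f₁ := derivWithin (coordField e γ J) (Icc a b))
    (by filter_upwards [eventually_mem_source hγ.smooth ht hs] with τ hτ using hY1 τ hτ.1 hτ.2)
    (hY1 t ht hs)
  rw [h2.derivWithin (hS t ht), hY1 t ht hs, hY t ht]
  set q : E × E := (e (γ t), coordField e γ (velocity (Icc a b) γ) t) with hqdef
  have hqv : coordField e γ (velocity (Icc a b) γ) t = q.2 := rfl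
  -- Thus (Y, Y') = f (y, -S) + f' (0, y). The first summand contributes f dS(y, -S), which cancels
  -- against Y''; the second gives 2 f' S by Euler, cancelling the two cross terms -f' S of Y''.
  -- Only f'' y remains.
  have h3 : ((f t • q.2, f t • -G.spray e q + derivWithin f (Icc a b) t • q.2) : E × E) =
      f t • (q.2, -G.spray e q) + derivWithin f (Icc a b) t • (0, q.2) := by simp
  rw [hqv, h3, map_add, map_smul, map_smul, G.fderiv_spray_fiber he hq]
  module

/-- A field `f γ̇` along a geodesic is a Jacobi field if and only if `f'' = 0`. -/
theorem IsGeodesic.isJacobiField_smul_velocity_iff (hγ : G.IsGeodesic a b γ) (hab : a < b)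
    {f : ℝ → ℝ} (hfs : ∀ t ∈ Icc a b, ContDiffWithinAt ℝ ∞ f (Icc a b) t)
    (hf : ∀ t ∈ Icc a b, J t = f t • velocity (Icc a b) γ t) :
    G.IsJacobiField a b γ J ↔
      ∀ t ∈ Icc a b, derivWithin (derivWithin f (Icc a b)) (Icc a b) t = 0 := by
  have hsm := hγ.contMDiffOn_of_eq_smul hab hfs hf
  constructor
  · intro hJ t ht
    have he := IsManifold.chart_mem_maximalAtlas (I := 𝓘(ℝ, E)) (n := ∞) (γ t)
    have hs := mem_chart_source E (γ t)
    have h := (hγ.jacobi_equation_iff hab he ht hs hsm).1 (hJ.equation _ he t ht hs)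
    rw [hγ.linearized_smul_velocity hab hfs hf he ht hs] at h
    exact (smul_eq_zero.1 h).resolve_right (hγ.coordField_velocity_ne_zero he ht hs)
  · intro h
    refine ⟨hsm, fun e he t ht hs => (hγ.jacobi_equation_iff hab he ht hs hsm).2 ?_⟩
    rw [hγ.linearized_smul_velocity hab hfs hf he ht hs, h t ht, zero_smul]

theorem IsGeodesic.isJacobiField_affine (hγ : G.IsGeodesic a b γ) (hab : a < b) {p r : ℝ}
    (hJ : ∀ t ∈ Icc a b, J t = (p * t + r) • velocity (Icc a b) γ t) :
    G.IsJacobiField a b γ J := by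
  have hS := uniqueDiffOn_Icc hab
  have h : ContDiff ℝ ∞ fun t : ℝ => p * t + r := by fun_prop
  refine (hγ.isJacobiField_smul_velocity_iff hab (f := fun t => p * t + r)
    (fun t _ => h.contDiffWithinAt) hJ).2 fun t ht => ?_
  have h1 : ∀ τ ∈ Icc a b, derivWithin (fun t => p * t + r) (Icc a b) τ = p := by
    intro τ hτ
    have := (((hasDerivWithinAt_id τ (Icc a b)).const_mul p).add_const r).derivWithin (hS τ hτ)
    simpa using this
  rw [derivWithin_congr h1 (h1 t ht)]
  simp

theorem IsGeodesic.exists_affine_of_mem_span (hγ : G.IsGeodesic a b γ) (hab : a < b)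
    (hJ : G.IsJacobiField a b γ J)
    (h : ∀ t ∈ Icc a b, J t ∈ Submodule.span ℝ {velocity (Icc a b) γ t}) :
    ∃ p r : ℝ, ∀ t ∈ Icc a b, J t = (p * t + r) • velocity (Icc a b) γ t := by
  have hS := uniqueDiffOn_Icc hab
  -- The factor must be a total function on ℝ; outside the interval it is set to 0.
  have h1 : ∀ t, ∃ r : ℝ, t ∈ Icc a b → J t = r • velocity (Icc a b) γ t := by
    intro t
    by_cases ht : t ∈ Icc a b
    · obtain ⟨r, hr⟩ := Submodule.mem_span_singleton.1 (h t ht)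
      exact ⟨r, fun _ => hr.symm⟩
    · exact ⟨0, fun h => absurd h ht⟩
  choose f hf using h1
  have hfs : ∀ t ∈ Icc a b, ContDiffWithinAt ℝ ∞ f (Icc a b) t := fun t ht =>
    hγ.contDiffWithinAt_of_eq_smul hab hJ.smooth hf ht
  have h2 := (hγ.isJacobiField_smul_velocity_iff hab hfs hf).1 hJ
  have h3 := eq_affine_of_hasDerivWithinAt hab
    (fun t ht => ((hfs t ht).differentiableWithinAt (by simp)).hasDerivWithinAt)
    (fun t ht => (((hfs t ht).derivWithin_infty hS ht).differentiableWithinAt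
      (by simp)).hasDerivWithinAt.congr_deriv (h2 t ht))
  refine ⟨derivWithin f (Icc a b) a, f a - derivWithin f (Icc a b) a * a, fun t ht => ?_⟩
  rw [hf t ht, (h3 t ht).2]
  congr 1
  ring

/-- Jacobi fields form a vector space. -/
theorem IsGeodesic.isJacobiField_add_smul (hγ : G.IsGeodesic a b γ) (hab : a < b)
    {J₁ J₂ : ∀ t, TangentSpace 𝓘(ℝ, E) (γ t)} (h₁ : G.IsJacobiField a b γ J₁)
    (h₂ : G.IsJacobiField a b γ J₂) (r : ℝ) :
    G.IsJacobiField a b γ (fun t => J₁ t + r • J₂ t) := by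
  have hS := uniqueDiffOn_Icc hab
  have hc : ∀ e : OpenPartialHomeomorph M E, coordField e γ (fun t => J₁ t + r • J₂ t) =
      fun t => coordField e γ J₁ t + r • coordField e γ J₂ t := fun e => funext fun t =>
    (coordField_add e γ J₁ _ t).trans (congrArg _ (coordField_smul e γ (fun _ => r) J₂ t))
  have hsm : ContMDiffOn 𝓘(ℝ, ℝ) 𝓘(ℝ, E).tangent ∞
      (fun t => (⟨γ t, J₁ t + r • J₂ t⟩ : TangentBundle 𝓘(ℝ, E) M)) (Icc a b) := by
    refine contMDiffOn_of_coordField hγ.smooth fun e he t ht hs => ?_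
    rw [hc]
    exact (contDiffWithinAt_coordField he h₁.smooth ht hs).add
      ((contDiffWithinAt_coordField he h₂.smooth ht hs).const_smul r)
  -- Linearity is checked on the linearized equation; in `jacobiOperatorCoord` the field enters
  -- through the variation, where linearity is not apparent.
  refine ⟨hsm, fun e he t ht hs => (hγ.jacobi_equation_iff hab he ht hs hsm).2 ?_⟩
  have e₁ := (hγ.jacobi_equation_iff hab he ht hs h₁.smooth).1 (h₁.equation e he t ht hs)
  have e₂ := (hγ.jacobi_equation_iff hab he ht hs h₂.smooth).1 (h₂.equation e he t ht hs)
  have d : ∀ {J : ∀ t, TangentSpace 𝓘(ℝ, E) (γ t)}, G.IsJacobiField a b γ J → ∀ τ ∈ Icc a b,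
      γ τ ∈ e.source → DifferentiableWithinAt ℝ (coordField e γ J) (Icc a b) τ :=
    fun h τ h1 h2 =>
      (contDiffWithinAt_coordField he h.smooth h1 h2).differentiableWithinAt (by simp)
  have d' : ∀ {J : ∀ t, TangentSpace 𝓘(ℝ, E) (γ t)}, G.IsJacobiField a b γ J →
      DifferentiableWithinAt ℝ (derivWithin (coordField e γ J) (Icc a b)) (Icc a b) t :=
    fun h => ((contDiffWithinAt_coordField he h.smooth ht hs).derivWithin_infty hS
      ht).differentiableWithinAt (by simp)
  have hD : ∀ τ ∈ Icc a b, γ τ ∈ e.source →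
      derivWithin (fun t => coordField e γ J₁ t + r • coordField e γ J₂ t) (Icc a b) τ =
      derivWithin (coordField e γ J₁) (Icc a b) τ +
        r • derivWithin (coordField e γ J₂) (Icc a b) τ := fun τ h1 h2 =>
    ((d h₁ τ h1 h2).hasDerivWithinAt.add
      ((d h₂ τ h1 h2).hasDerivWithinAt.const_smul r)).derivWithin (hS τ h1)
  have hD2 := (((d' h₁).hasDerivWithinAt.add ((d' h₂).hasDerivWithinAt.const_smul
    r)).congr_of_eventuallyEq (by
      filter_upwards [eventually_mem_source hγ.smooth ht hs] with τ hτ using hD τ hτ.1 hτ.2)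
    (hD t ht hs)).derivWithin (hS t ht)
  rw [hc, hD2, hD t ht hs]
  have h3 : ∀ x y z w : E, ((x + r • y, z + r • w) : E × E) = (x, z) + r • (y, w) :=
    fun x y z w => by simp
  rw [h3, map_add, map_smul, add_add_add_comm, e₁, ← smul_add, e₂, smul_zero, add_zero]

/-- The tangent part of a Jacobi field is a Jacobi field. -/
theorem IsGeodesic.isJacobiField_tanPart (hγ : G.IsGeodesic a b γ) (hab : a < b)
    (hJ : G.IsJacobiField a b γ J) : G.IsJacobiField a b γ (G.tanPart (Icc a b) γ J) := by
  obtain ⟨p, r, h⟩ := hγ.fundamentalTensor_jacobi_eq hab hJ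
  -- The numerator of the coefficient is p t + r and its denominator is L(γ̇), constant along γ. If
  -- that constant is 0, the convention `x / 0 = 0` makes both sides the zero field.
  refine hγ.isJacobiField_affine hab (p := p / G.L ⟨γ a, velocity (Icc a b) γ a⟩)
    (r := r / G.L ⟨γ a, velocity (Icc a b) γ a⟩) fun t ht => ?_
  rw [tanPart, (h t ht).2, hγ.fundamentalTensor_velocity_velocity ht, hγ.L_velocity_eq hab ht]
  congr 1
  ring

end

end PseudoFinslerMetric

/-! ### Assembly of the three statements. -/

theorem lemma3p17 {E : Type*} [NormedAddCommGroup E] [NormedSpace ℝ E] [FiniteDimensional ℝ E]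
    {M : Type*} [TopologicalSpace M] [ChartedSpace E M] [IsManifold 𝓘(ℝ, E) ∞ M]
    (G : PseudoFinslerMetric E M) {a b : ℝ} (hab : a < b) (γ : ℝ → M) (hγ : G.IsGeodesic a b γ)
    (J : ∀ t, TangentSpace 𝓘(ℝ, E) (γ t)) :
    (G.IsJacobiField a b γ J →
      ((∀ t ∈ Icc a b, J t ∈ Submodule.span ℝ {PseudoFinslerMetric.velocity (Icc a b) γ t}) ↔
        ∃ a₁ a₂ : ℝ, ∀ t ∈ Icc a b,
          J t = (a₁ * t + a₂) • PseudoFinslerMetric.velocity (Icc a b) γ t) ∧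
      List.TFAE [
        ∀ t ∈ Icc a b, fundamentalTensor G.L (PseudoFinslerMetric.velocity (Icc a b) γ t)
          (PseudoFinslerMetric.velocity (Icc a b) γ t) (J t) = 0,
        ∃ t₁ ∈ Icc a b, ∃ t₂ ∈ Icc a b, t₁ ≠ t₂ ∧
          fundamentalTensor G.L (PseudoFinslerMetric.velocity (Icc a b) γ t₁)
            (PseudoFinslerMetric.velocity (Icc a b) γ t₁) (J t₁) = 0 ∧
          fundamentalTensor G.L (PseudoFinslerMetric.velocity (Icc a b) γ t₂)
            (PseudoFinslerMetric.velocity (Icc a b) γ t₂) (J t₂) = 0,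
        ∃ t₀ ∈ Icc a b,
          fundamentalTensor G.L (PseudoFinslerMetric.velocity (Icc a b) γ t₀)
            (PseudoFinslerMetric.velocity (Icc a b) γ t₀) (J t₀) = 0 ∧
          fundamentalTensor G.L (PseudoFinslerMetric.velocity (Icc a b) γ t₀)
            (PseudoFinslerMetric.velocity (Icc a b) γ t₀) (G.covDeriv (Icc a b) γ J t₀) = 0]) ∧
    ((∀ t ∈ Icc a b, G.L ⟨γ t, PseudoFinslerMetric.velocity (Icc a b) γ t⟩ ≠ 0) →
      (G.IsJacobiField a b γ J ↔
        G.IsJacobiField a b γ (G.norPart (Icc a b) γ J) ∧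
        G.IsJacobiField a b γ (G.tanPart (Icc a b) γ J))) := by
  refine ⟨fun hJ => ⟨⟨hγ.exists_affine_of_mem_span hab hJ, ?_⟩, ?_⟩, fun _ => ⟨fun hJ => ?_, ?_⟩⟩
  · rintro ⟨p, r, h⟩ t ht
    exact Submodule.mem_span_singleton.2 ⟨_, (h t ht).symm⟩
  · obtain ⟨p, r, h⟩ := hγ.fundamentalTensor_jacobi_eq hab hJ
    have ha := left_mem_Icc.2 hab.le
    have hb := right_mem_Icc.2 hab.le
    tfae_have 1 → 2 := fun h1 => ⟨a, ha, b, hb, hab.ne, h1 a ha, h1 b hb⟩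
    tfae_have 2 → 3 := by
      rintro ⟨t₁, h₁, t₂, h₂, hne, e₁, e₂⟩
      have hp : p = 0 := by
        rw [(h t₁ h₁).2] at e₁
        rw [(h t₂ h₂).2] at e₂
        have : p * (t₁ - t₂) = 0 := by linarith
        exact (mul_eq_zero.1 this).resolve_right (sub_ne_zero.2 hne)
      exact ⟨t₁, h₁, e₁, (h t₁ h₁).1.trans hp⟩
    tfae_have 3 → 1 := by
      rintro ⟨t₀, h₀, e₁, e₂⟩ t ht
      rw [(h t₀ h₀).1] at e₂
      rw [(h t₀ h₀).2, e₂, zero_mul, zero_add] at e₁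
      rw [(h t ht).2, e₂, e₁, zero_mul, zero_add]
    tfae_finish
  · have hT := hγ.isJacobiField_tanPart hab hJ
    refine ⟨?_, hT⟩
    have h : G.norPart (Icc a b) γ J = fun t => J t + (-1 : ℝ) • G.tanPart (Icc a b) γ J t :=
      funext fun t => by
        rw [PseudoFinslerMetric.norPart, neg_smul, one_smul, sub_eq_add_neg]
    rw [h]
    exact hγ.isJacobiField_add_smul hab hJ hT (-1)
  · rintro ⟨hN, hT⟩
    have h : J = fun t => G.norPart (Icc a b) γ J t + (1 : ℝ) • G.tanPart (Icc a b) γ J t :=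
      funext fun t => by
        rw [PseudoFinslerMetric.norPart, one_smul, sub_add_cancel]
    rw [h]
    exact hγ.isJacobiField_add_smul hab hN hT 1
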